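/- Let $K$ be a field of characteristic $2$, let $V$ be a finite-dimensional vector space over $K$, and let $Q$ be a quadratic form on $V$ whose associated bilinear form $f_Q(u,w)=Q(u+w)-Q(u)-Q(w)$ is nondegenerate. Let $O(V,Q)$ be the group of all linear automorphisms of $V$ that preserve $Q$. Let $\varphi\in O(V,Q)$ be orthogonally indecomposable of type 1, that is: - there is no $\varphi$-invariant subspace $W$ with $0\neq W\neq V$ such that the restriction of $f_Q$ to $W$ is nondegenerate; and - $\varphi$ is bicyclic with elementary divisors $e_1=e_2=(x+1)^m$ for some $m\ge 1$, that is, the $K[x]$-module $V$ on which $x$ acts as $\varphi$ is isomorphic to $K[x]/((x+1)^m)\oplus K[x]/((x+1)^m)$. Say that $\varphi$ is of type 1o (respectively 1e) if its minimal polynomial has odd (respectively even) degree. Then: 1. If $\varphi$ is of type 1e, then (a) $\varphi$ is hyperbolic, that is, $V=U\oplus W$ for some $\varphi$-invariant subspaces $U,W$ of $V$ with $Q|_U=0$ and $Q|_W=0$; (b) $\varphi$ is the unipotent factor in the multiplicative Jordan–Chevalley decomposition of a cyclic transformation in $O(V,Q)$, that is, there are $\eta\in O(V,Q)$ and $\sigma\in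 GL(V)$ such that $V$ is spanned by $v,\eta v,\eta^2 v,\dots$ for some $v\in V$, the map $\sigma$ is diagonalizable over an algebraic closure of $K$, and $\eta=\sigma\varphi=\varphi\sigma$. 2. There is $\psi\in O(V,Q)$ with $\psi^2=\varphi$ if and only if $\varphi$ is of type 1o. -/

import Mathlib

open Polynomial

namespace QuadSpace

variable {K V : Type*} [Field K] [AddCommGroup V] [Module K V]

/-- A quadratic form `Q` is nondefective if its associated bilinear form
`f_Q(u, w) = Q(u + w) - Q(u) - Q(w)` is nondegenerate. -/
def Nondefective (Q : QuadraticForm K V) : Prop :=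
  (QuadraticMap.polarBilin Q).Nondegenerate

/-- The orthogonal group `O(V, Q)`: all linear automorphisms of `V` preserving `Q`. -/
def O (Q : QuadraticForm K V) : Subgroup (V ≃ₗ[K] V) where
  carrier := {g | ∀ v, Q (g v) = Q v}
  mul_mem' {a b} ha hb v := (ha (b v)).trans (hb v)
  one_mem' _ := rfl
  inv_mem' {a} ha v := by
    have h := ha (a⁻¹ v)
    rw [← LinearEquiv.mul_apply, mul_inv_cancel] at h
    exact h.symm

/-- An automorphism of `V`, regarded as an endomorphism of `V`. -/
abbrev toEnd (g : V ≃ₗ[K] V) : Module.End K V := (g : V →ₗ[K] V)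

/-- `U` is totally isotropic: `Q` vanishes on `U`. -/
def TotallyIsotropic (Q : QuadraticForm K V) (U : Submodule K V) : Prop :=
  ∀ u ∈ U, Q u = 0

/-- `U` is invariant under the endomorphism `f`. -/
def Invariant (f : Module.End K V) (U : Submodule K V) : Prop :=
  ∀ u ∈ U, f u ∈ U

/-- `φ ∈ O(V, Q)` is orthogonally indecomposable if the only `φ`-invariant subspaces of `V` on
which `Q` is nondefective are (possibly) `0` and `V`. -/
def OrthogonallyIndecomposable {Q : QuadraticForm K V} (φ : O Q) : Prop :=
  ∀ W : Submodule K V, Invariant (toEnd φ.1) W → Nondefective (Q.comp W.subtype) → W = ⊥ ∨ W = ⊤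

/-- `f` is bicyclic with elementary divisors `e₁ = e₂ = p`: the `K[X]`-module `V`, on which `X`
acts as `f`, is isomorphic to `K[X]/(p) ⊕ K[X]/(p)`. -/
def BicyclicWith (f : Module.End K V) (p : K[X]) : Prop :=
  Nonempty (Module.AEval' f ≃ₗ[K[X]] (K[X] ⧸ Ideal.span {p}) × (K[X] ⧸ Ideal.span {p}))

/-- `φ` is orthogonally indecomposable of type 1: orthogonally indecomposable, and bicyclic with
elementary divisors `e₁ = e₂ = (X ± 1)^m` for some `m ≥ 1`. -/
def IsType1 {Q : QuadraticForm K V} (φ : O Q) : Prop :=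
  OrthogonallyIndecomposable φ ∧ ∃ m : ℕ, 1 ≤ m ∧
    (BicyclicWith (toEnd φ.1) ((X - 1) ^ m) ∨ BicyclicWith (toEnd φ.1) ((X + 1) ^ m))

/-- Type 1o: type 1, and the minimal polynomial has odd degree. -/
def IsType1o {Q : QuadraticForm K V} (φ : O Q) : Prop :=
  IsType1 φ ∧ Odd (minpoly K (toEnd φ.1)).natDegree

/-- Type 1e: type 1, and the minimal polynomial has even degree. -/
def IsType1e {Q : QuadraticForm K V} (φ : O Q) : Prop :=
  IsType1 φ ∧ Even (minpoly K (toEnd φ.1)).natDegree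

/-- `φ` is hyperbolic: `V = U ⊕ W` with `U`, `W` totally isotropic and `φ`-invariant. -/
def IsHyperbolic {Q : QuadraticForm K V} (φ : O Q) : Prop :=
  ∃ U W : Submodule K V, IsCompl U W ∧
    TotallyIsotropic Q U ∧ TotallyIsotropic Q W ∧
    Invariant (toEnd φ.1) U ∧ Invariant (toEnd φ.1) W

/-- `f` is cyclic: `V` is spanned by `v, f v, f² v, …` for some vector `v`. -/
def IsCyclicEnd (f : Module.End K V) : Prop :=
  ∃ v : V, Submodule.span K (Set.range fun k : ℕ => (f ^ k) v) = ⊤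

/-- `η = s u = u s` is the multiplicative Jordan-Chevalley decomposition of `η` with semisimple
factor `s` and unipotent factor `u`. Semisimple is meant absolutely, as usual for this
decomposition: `s` becomes diagonalizable over an algebraic closure of `K`, that is, its minimal
polynomial is separable. This implies that every `s`-invariant subspace has an `s`-invariant
complement, and is equivalent to it when `K` is perfect. -/
def IsJordanChevalley (η s u : V ≃ₗ[K] V) : Prop :=
  η = s * u ∧ Commute s u ∧ (minpoly K (toEnd s)).Separable ∧ IsNilpotent (toEnd u - 1)

end QuadSpace

set_option linter.unusedSectionVars false

/-! Let `A` be the Laurent polynomials in `φ`, let `t = φ - 1`, and let `st` be the involution `φ ↦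
φ⁻¹`, which gives adjoints for the polar form `f`. Then `V` is free of rank 2 over `A/(t^m)`. In
characteristic 2, `st` fixes the leading term of each `t^n`, so `f(t^(m-1) u, w)` is a symmetric
form on `V/tV`, the residue form. It is nonzero and, by indecomposability, alternating: if
`f(t^(m-1) v, v) ≠ 0`, the orbit of `v` would be a nondegenerate invariant subspace of dimension at
most `m < dim V`. By `map_aeval_eq_zero_of_map_pow`, an orbit form `a ↦ Q(a v)` is controlled by the
scalars `Q(t^i v)`, and these are matched by solving triangular systems.

If `m = 2k`, then `Q(t^k v) = f(t^(m-1) v, v) = 0`, so all corrections of generators can be taken in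
`tA`, and `t`-adic iteration yields generators `u, w` with `Q(au) = Q(aw) = f(au, aw) = 0`
(`exists_hyperbolic_generators`). Their orbits are the hyperbolic decomposition; `u ↦ w`, `w ↦ u +
w` is an isometry of order 3 commuting with `φ`, and its product with `φ` is cyclic. If `ψ² = φ`,
then `s = ψ - 1` has `s² = t`, and the same identity applied to `ψ` gives `f(t^(m-1) v, s v) = 0`.
So `s` fixes every line of the residue plane; being nilpotent it vanishes there, whence `sV ⊆ tV =
s²V` and `t = 0` (`eq_zero_of_sq_eq`), against `m ≥ 2`.

If `m = 2k + 1`, then `v ↦ Q(t^k v)` has the residue form as polar form, so it is nonzero on some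
generator. A Hensel argument then provides generators `e, w` for which `e ↦ e + w`, `w ↦ te + w` is
an isometry (`exists_sqrt_generators`); its square is `1 + t`. -/

namespace QuadSpace

/-! ### Triangular systems and invariant quadratic forms on an algebra. -/

section Generalities

open QuadraticMap

variable {K : Type*} [Field K]

/-- A triangular system of linear functionals with nonzero diagonal can be solved. -/
theorem exists_mem_span_forall_apply_eq {E : Type*} [AddCommGroup E] [Module K E]
    (F : ℕ → E →ₗ[K] K) (y : ℕ → E) (n : ℕ) (hdiag : ∀ i < n, F i (y i) ≠ 0)
    (hzero : ∀ i j, i < j → j < n → F j (y i) = 0) (c : ℕ → K) :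
    ∃ z ∈ Submodule.span K (y '' Set.Iio n), ∀ i < n, F i z = c i := by
  induction n generalizing c with
  | zero => exact ⟨0, zero_mem _, by simp⟩
  | succ n ih =>
    obtain ⟨z, hz, hzc⟩ := ih (fun i hi => hdiag i (by omega))
      (fun i j hij hj => hzero i j hij (by omega)) (fun i => c i - c n / F n (y n) * F i (y n))
    have hzn : F n z = 0 := by
      have : Submodule.span K (y '' Set.Iio n) ≤ LinearMap.ker (F n) := by
        rw [Submodule.span_le]
        rintro _ ⟨i, hi, rfl⟩
        exact hzero i n hi (by omega)
      exact this hz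
    refine ⟨z + (c n / F n (y n)) • y n, add_mem (Submodule.span_mono
      (Set.image_mono fun i (hi : i < n) => show i < n + 1 by omega) hz)
      (Submodule.smul_mem _ _ (Submodule.subset_span ⟨n, by simp, rfl⟩)), fun i hi => ?_⟩
    rcases Nat.lt_succ_iff_lt_or_eq.mp hi with h | rfl
    · simp [hzc i h]
    · simp [hzn, div_mul_cancel₀ _ (hdiag i hi)]

variable [CharP K 2]

theorem algebra_two_eq_zero (K : Type*) [Field K] [CharP K 2] (A : Type*) [CommRing A]
    [Algebra K A] : (2 : A) = 0 := by
  have := congrArg (algebraMap K A) (CharP.cast_eq_zero K 2)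
  simpa only [Nat.cast_ofNat, map_ofNat, map_zero] using this

theorem polar_self_eq_zero {V : Type*} [AddCommGroup V] [Module K V] (Q : QuadraticForm K V)
    (v : V) : polar Q v v = 0 := by
  rw [polar_self, two_nsmul, CharTwo.add_self_eq_zero]

theorem map_add_eq {V : Type*} [AddCommGroup V] [Module K V] (Q : QuadraticForm K V) (v w : V) :
    Q (v + w) = Q v + Q w + polar Q v w := by
  simp [polar]

section Invariant

variable {A : Type*} [CommRing A] [Algebra K A]

/-- A quadratic form that is invariant under multiplication by `1 + t` and vanishes on the powers
of `t` vanishes on all polynomials in `t`. -/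
theorem map_aeval_eq_zero_of_map_pow (q : QuadraticForm K A) (t : A)
    (hinv : ∀ a, q ((1 + t) * a) = q a) (hpow : ∀ i : ℕ, q (t ^ i) = 0) (p : K[X]) :
    q (aeval t p) = 0 := by
  have two : (2 : K) = 0 := algebra_two_eq_zero K K
  have hpol : ∀ a b, polar q ((1 + t) * a) ((1 + t) * b) = polar q a b := fun a b => by
    simp only [polar, ← mul_add, hinv]
  have h1 : ∀ a, polar q a (t * a) = q (t * a) := fun a => by
    have h := hinv a
    rw [add_mul, one_mul, map_add_eq] at h
    linear_combination h - q (t * a) * two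
  have h2 : ∀ a b, polar q a (t * b) = polar q (t * a) (t * b) + polar q (t * a) b := fun a b => by
    have h := hpol a b
    simp only [add_mul, one_mul, polar_add_left, polar_add_right] at h
    linear_combination h - (polar q (t * a) (t * b) + polar q (t * a) b) * two
  -- Induction on the gap between exponents; `h2` expresses gap `d + 2` through gaps `d + 1` and
  -- `d`, so two consecutive gaps are carried.
  have hdiff : ∀ d i : ℕ, polar q (t ^ i) (t ^ (i + d)) = 0 ∧
      polar q (t ^ i) (t ^ (i + (d + 1))) = 0 := by
    intro d
    induction d with
    | zero =>
      intro i
      refine ⟨by rw [add_zero, polar_self_eq_zero], ?_⟩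
      have := h1 (t ^ i)
      rwa [← pow_succ', hpow] at this
    | succ d ih =>
      intro i
      refine ⟨(ih i).2, ?_⟩
      have h := h2 (t ^ i) (t ^ (i + d + 1))
      rw [← pow_succ', ← pow_succ'] at h
      have e1 := (ih (i + 1)).1
      have e2 := (ih (i + 1)).2
      rw [show i + 1 + d = i + d + 1 by omega] at e1
      rw [show i + 1 + (d + 1) = i + d + 1 + 1 by omega] at e2
      rw [show i + (d + 1 + 1) = i + d + 1 + 1 by omega, h, e1, e2, add_zero]
  have hmono : ∀ i j : ℕ, polar q (t ^ i) (t ^ j) = 0 := by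
    intro i j
    rcases le_total i j with h | h
    · obtain ⟨d, rfl⟩ := Nat.exists_eq_add_of_le h
      exact (hdiff d i).1
    · obtain ⟨d, rfl⟩ := Nat.exists_eq_add_of_le h
      rw [polar_comm]
      exact (hdiff d j).1
  have hbil : ∀ p r : K[X], polar q (aeval t p) (aeval t r) = 0 := by
    intro p r
    induction p using Polynomial.induction_on' with
    | add p p' hp hp' => rw [map_add, polar_add_left, hp, hp', add_zero]
    | monomial i c =>
      induction r using Polynomial.induction_on' with
      | add p p' hp hp' => rw [map_add, polar_add_right, hp, hp', add_zero]
      | monomial j d =>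
        simp [aeval_monomial, ← Algebra.smul_def, polar_smul_left, polar_smul_right, hmono]
  induction p using Polynomial.induction_on' with
  | add p p' hp hp' => rw [map_add, map_add_eq, hp, hp', hbil, add_zero, add_zero]
  | monomial i c => simp [aeval_monomial, ← Algebra.smul_def, QuadraticMap.map_smul, hpow]

end Invariant

end Generalities

/-! ### Orbit maps and the algebra with involution acting on `V`. -/

section Orbit

variable {K V : Type*} [Field K] [AddCommGroup V] [Module K V]

/-- `a ↦ a • v` as a `K`-linear map. -/
def orbitMap (A : Type*) [CommRing A] [Algebra K A] [Module A V] [IsScalarTower K A V] (v : V) :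
    A →ₗ[K] V :=
  (LinearMap.toSpanSingleton A V v).restrictScalars K

@[simp] theorem orbitMap_apply {A : Type*} [CommRing A] [Algebra K A] [Module A V]
    [IsScalarTower K A V] (v : V) (a : A) : orbitMap (K := K) A v a = a • v := rfl

end Orbit

/-- `A` is a commutative algebra with an automorphism `st` acting on the quadratic space `(V, Q)`,
such that `st` induces the adjoint with respect to the polar form, and `1 + t` acts as an isometry
`φ` with `(φ - 1) ^ m = 0`. The model is the algebra of Laurent polynomials in `φ`. -/
structure UnipotentAction {K V A : Type*} [Field K] [AddCommGroup V] [Module K V] [CommRing A]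
    [Algebra K A] [Module A V] (Q : QuadraticForm K V) (st : A →ₐ[K] A) (t : A) (m : ℕ) :
    Prop where
  isometry : ∀ v : V, Q ((1 + t) • v) = Q v
  adjoint : ∀ (a : A) (u w : V), QuadraticMap.polar Q (a • u) w = QuadraticMap.polar Q u (st a • w)
  star_star : st (st t) = t
  add_star : t + st t = t * st t
  exists_eq : ∀ a : A, ∃ p q : K[X], a = aeval (t * st t) p + aeval (t * st t) q * t
  pow_smul : ∀ v : V, t ^ m • v = 0

namespace UnipotentAction

open QuadraticMap

variable {K V A : Type*} [Field K] [AddCommGroup V] [Module K V] [CommRing A]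
  [Algebra K A] [Module A V] [IsScalarTower K A V]
  {Q : QuadraticForm K V} {st : A →ₐ[K] A} {t : A} {m : ℕ}

theorem star_norm (H : UnipotentAction Q st t m) : st (t * st t) = t * st t := by
  rw [map_mul, H.star_star, mul_comm]

theorem star_aeval (H : UnipotentAction Q st t m) (p : K[X]) :
    st (aeval (t * st t) p) = aeval (t * st t) p := by
  rw [← Polynomial.aeval_algHom_apply, H.star_norm]

/-- Modulo `t` the norm `t * st t` vanishes, so only the constant term of `p` survives: residues are
scalars. -/
theorem exists_residue (H : UnipotentAction Q st t m) (a : A) :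
    ∃ (c : K) (b : A), a = algebraMap K A c + t * b := by
  obtain ⟨p, q, rfl⟩ := H.exists_eq a
  refine ⟨p.coeff 0, st t * aeval (t * st t) p.divX + aeval (t * st t) q, ?_⟩
  conv_lhs => rw [← Polynomial.divX_mul_X_add p]
  simp only [map_add, map_mul, aeval_X, aeval_C]
  ring

theorem exists_aeval (H : UnipotentAction Q st t m) (n : ℕ) (a : A) :
    ∃ (p : K[X]) (b : A), a = aeval t p + t ^ n * b := by
  induction n with
  | zero => exact ⟨0, a, by simp⟩
  | succ n ih =>
    obtain ⟨p, b, hb⟩ := ih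
    obtain ⟨c, d, hd⟩ := H.exists_residue b
    refine ⟨p + X ^ n * C c, d, ?_⟩
    rw [hb, hd]
    simp only [map_add, map_mul, map_pow, aeval_X, aeval_C]
    ring

theorem pow_smul_of_le (H : UnipotentAction Q st t m) {n : ℕ} (h : m ≤ n) (v : V) :
    t ^ n • v = 0 := by
  obtain ⟨d, rfl⟩ := Nat.exists_eq_add_of_le h
  rw [pow_add, mul_comm, mul_smul, H.pow_smul, smul_zero]

theorem smul_eq_zero_of_dvd (H : UnipotentAction Q st t m) {a : A} (h : t ^ m ∣ a) (v : V) :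
    a • v = 0 := by
  obtain ⟨b, rfl⟩ := h
  rw [mul_smul, H.pow_smul]

theorem exists_smul_eq_aeval (H : UnipotentAction Q st t m) (a : A) :
    ∃ p : K[X], ∀ v : V, a • v = aeval t p • v := by
  obtain ⟨p, b, rfl⟩ := H.exists_aeval m a
  exact ⟨p, fun v => by rw [add_smul, mul_smul, H.pow_smul, add_zero]⟩

theorem dvd_star (H : UnipotentAction Q st t m) {n : ℕ} {a : A} (h : t ^ n ∣ a) :
    t ^ n ∣ st a := by
  obtain ⟨b, rfl⟩ := h
  rw [map_mul, map_pow]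
  refine Dvd.dvd.mul_right (pow_dvd_pow_of_dvd ⟨st t - 1, ?_⟩ n) _
  linear_combination H.add_star

/-! ### The residue form and the values of `Q` on powers of `t`. -/

section Pairing

theorem polar_smul_smul (H : UnipotentAction Q st t m) (a b : A) (u w : V) :
    polar Q (a • u) (b • w) = polar Q u ((st a * b) • w) := by
  rw [H.adjoint, mul_smul]

/-- From `add_star`, `st t = t * (st t - 1)`, so `st t` is `-t` modulo `t ^ 2`. In characteristic 2
the sign disappears, which makes the residue form symmetric. -/
theorem exists_star_pow (H : UnipotentAction Q st t m) (n : ℕ) :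
    ∃ b, st (t ^ n) = (-1) ^ n * t ^ n + t ^ (n + 1) * b := by
  have h : st t = t * (st t - 1) := by linear_combination H.add_star
  obtain ⟨b, hb⟩ : st t ∣ (st t - 1) ^ n - (-1) ^ n := by
    have := sub_dvd_pow_sub_pow (st t - 1) (-1) n
    rwa [show st t - 1 - -1 = st t by ring] at this
  refine ⟨(st t - 1) * b, ?_⟩
  rw [map_pow]
  conv_lhs => rw [h, mul_pow, show (st t - 1) ^ n = (-1) ^ n + t * (st t - 1) * b by
    rw [← h]; linear_combination hb]
  ring

variable [CharP K 2]

theorem exists_star_pow' (H : UnipotentAction Q st t m) (n : ℕ) :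
    ∃ b, st (t ^ n) = t ^ n + t ^ (n + 1) * b := by
  obtain ⟨b, hb⟩ := H.exists_star_pow n
  have : (-1 : A) = 1 := by linear_combination -algebra_two_eq_zero K A
  exact ⟨b, by simpa [this] using hb⟩

theorem polar_pow_smul_eq_zero (H : UnipotentAction Q st t m) {a b : ℕ} (h : m ≤ a + b)
    (u w : V) : polar Q (t ^ a • u) (t ^ b • w) = 0 := by
  obtain ⟨c, hc⟩ := H.exists_star_pow a
  rw [H.polar_smul_smul, hc, H.smul_eq_zero_of_dvd, polar_zero_right]
  refine (pow_dvd_pow t h).trans ⟨(-1) ^ a + t * c, ?_⟩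
  ring

theorem polar_pow_smul_left (H : UnipotentAction Q st t m) {n : ℕ} (h : n + 1 = m) (u w : V) :
    polar Q (t ^ n • u) w = polar Q u (t ^ n • w) := by
  obtain ⟨c, hc⟩ := H.exists_star_pow' n
  rw [H.adjoint, hc, h, add_smul, mul_smul, H.pow_smul, add_zero]

theorem polar_pow_smul_eq (H : UnipotentAction Q st t m) {a b n : ℕ} (h : n + 1 = m)
    (hab : a + b = n) (u w : V) : polar Q (t ^ a • u) (t ^ b • w) = polar Q (t ^ n • u) w := by
  obtain ⟨c, hc⟩ := H.exists_star_pow' a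
  rw [H.polar_smul_smul, hc, H.polar_pow_smul_left h, add_mul, ← pow_add, hab, add_smul,
    H.smul_eq_zero_of_dvd (a := _ * t ^ b), add_zero]
  rw [← h, ← hab]
  exact ⟨c, by ring⟩

theorem polar_pow_smul_algebraMap_add (H : UnipotentAction Q st t m) {n : ℕ} (h : n + 1 = m)
    (c : K) (b : A) (u w : V) :
    polar Q (t ^ n • u) ((algebraMap K A c + t * b) • w) = c * polar Q (t ^ n • u) w := by
  have := H.polar_pow_smul_eq_zero (a := n) (b := 1) (by omega) u (b • w)
  rw [pow_one] at this
  rw [add_smul, mul_smul, polar_add_right, this, add_zero, algebraMap_smul, polar_smul_right,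
    smul_eq_mul]

theorem polar_self_smul (H : UnipotentAction Q st t m) (v : V) : polar Q v (t • v) = Q (t • v) := by
  have h := H.isometry v
  rw [add_smul, one_smul, map_add_eq] at h
  linear_combination h - Q (t • v) * algebra_two_eq_zero K K

/-- This is `polar_self_smul` at `t ^ (k - 1) • v`. It makes `Q` vanish on `t ^ k V` once the
residue form is alternating, and applied to a square root of `φ` it gives the obstruction. -/
theorem map_pow_smul_eq (H : UnipotentAction Q st t m) {k : ℕ} (hk : 1 ≤ k) (hm : m = 2 * k)
    (v : V) : Q (t ^ k • v) = polar Q (t ^ (2 * k - 1) • v) v := by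
  rw [← H.polar_pow_smul_eq (a := k - 1) (b := k) (n := 2 * k - 1) (by omega) (by omega)]
  obtain ⟨j, rfl⟩ := Nat.exists_eq_add_of_le' hk
  rw [Nat.add_sub_cancel, pow_succ', mul_smul, H.polar_self_smul]

end Pairing

/-! ### Independence of generators and reduction to powers of `t`. -/

section Residue

variable [CharP K 2]

/-- If `e`, `e'` are nonorthogonal modulo `t` and isotropic for the residue form then they are
independent over `A`. -/
theorem pow_dvd_of_smul_add_smul (H : UnipotentAction Q st t m) {n : ℕ} (h : n + 1 = m)
    (halt : ∀ v, polar Q (t ^ n • v) v = 0) {e e' : V} (hne : polar Q (t ^ n • e) e' ≠ 0)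
    {a b : A} (hab : a • e + b • e' = 0) : t ^ m ∣ a ∧ t ^ m ∣ b := by
  have hne' : polar Q (t ^ n • e') e ≠ 0 := by
    rwa [polar_comm, ← H.polar_pow_smul_left h]
  suffices ∀ j ≤ m, t ^ j ∣ a ∧ t ^ j ∣ b from this m le_rfl
  intro j
  induction j with
  | zero => simp
  | succ j ih =>
    intro hj
    obtain ⟨⟨a', rfl⟩, ⟨b', rfl⟩⟩ := ih (by omega)
    obtain ⟨c, a'', rfl⟩ := H.exists_residue a'
    obtain ⟨d, b'', rfl⟩ := H.exists_residue b'
    -- Multiplying the relation by `t ^ (n - j)` raises the common factor to `t ^ n`, where the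
    -- residue form sees exactly `c` and `d`.
    have h0 : t ^ n • ((algebraMap K A c + t * a'') • e + (algebraMap K A d + t * b'') • e') = 0 := by
      have := congrArg (fun v => t ^ (n - j) • v) hab
      simp only [smul_add, smul_zero, smul_smul, ← mul_assoc, ← pow_add] at this
      rw [show n - j + j = n by omega] at this
      rw [smul_add, smul_smul, smul_smul, this]
    have key : ∀ w, c * polar Q (t ^ n • w) e + d * polar Q (t ^ n • w) e' = 0 := by
      intro w
      rw [← H.polar_pow_smul_algebraMap_add h c a'', ← H.polar_pow_smul_algebraMap_add h d b'',
        ← polar_add_right, H.polar_pow_smul_left h, h0, polar_zero_right]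
    have hd : d = 0 := by
      have := key e
      rw [halt, mul_zero, zero_add] at this
      exact (mul_eq_zero.mp this).resolve_right hne
    have hc : c = 0 := by
      have := key e'
      rw [halt, mul_zero, add_zero] at this
      exact (mul_eq_zero.mp this).resolve_right hne'
    subst hc hd
    exact ⟨⟨a'', by rw [map_zero]; ring⟩, ⟨b'', by rw [map_zero]; ring⟩⟩

/-- A quadratic identity between orbits needs to be checked for powers of `t` only. -/
theorem map_smul_eq_polar (H : UnipotentAction Q st t m) {v e z : V}
    (h : ∀ i : ℕ, Q (t ^ i • v) = polar Q (t ^ i • e) (t ^ i • z)) (a : A) :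
    Q (a • v) = polar Q (a • e) (a • z) := by
  let q : QuadraticForm K A := Q.comp (orbitMap A v) -
    LinearMap.BilinMap.toQuadraticMap
      ((polarBilin Q).compl₁₂ (orbitMap (K := K) A e) (orbitMap (K := K) A z))
  have hq : ∀ a, q a = Q (a • v) - polar Q (a • e) (a • z) := fun a => rfl
  have hiso : ∀ u w : V, polar Q ((1 + t) • u) ((1 + t) • w) = polar Q u w := fun u w => by
    simp only [polar, ← smul_add, H.isometry]
  obtain ⟨p, hp⟩ := H.exists_smul_eq_aeval a
  have := map_aeval_eq_zero_of_map_pow q t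
    (fun a => by rw [hq, hq, mul_smul, mul_smul, mul_smul, H.isometry, hiso])
    (fun i => by rw [hq, h, sub_self]) p
  rw [hq, ← hp, ← hp, ← hp] at this
  exact sub_eq_zero.mp this

theorem polar_smul_smul_eq_zero (H : UnipotentAction Q st t m) {u w : V}
    (h : ∀ i : ℕ, polar Q (t ^ i • u) (t ^ i • w) = 0) (a : A) :
    polar Q (a • u) (a • w) = 0 := by
  rw [← H.map_smul_eq_polar (v := 0) (fun i => by rw [h, smul_zero, QuadraticMap.map_zero]),
    smul_zero, QuadraticMap.map_zero]

theorem map_smul_eq_zero (H : UnipotentAction Q st t m) {v : V} (h : ∀ i : ℕ, Q (t ^ i • v) = 0)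
    (a : A) : Q (a • v) = 0 := by
  rw [H.map_smul_eq_polar (v := v) (e := 0) (z := 0) (fun i => by simp [h]), smul_zero,
    polar_zero_left]

end Residue

end UnipotentAction

end QuadSpace

/-! ### Even exponent: hyperbolic generators. -/

namespace QuadSpace

namespace UnipotentAction

open QuadraticMap

variable {K V A : Type*} [Field K] [CharP K 2] [AddCommGroup V] [Module K V] [CommRing A]
  [Algebra K A] [Module A V] [IsScalarTower K A V]
  {Q : QuadraticForm K V} {st : A →ₐ[K] A} {t : A} {m : ℕ}

/-- Used with `r = 0` for even and `r = 1` for odd exponent. -/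
theorem exists_dvd_forall_polar_eq (H : UnipotentAction Q st t m) {k r : ℕ}
    (hm : 2 * k + r = m) {e e' : V} (hne : polar Q (t ^ (m - 1) • e) e' ≠ 0) (c : ℕ → K) :
    ∃ y, t ∣ y ∧ ∀ i < k, polar Q (t ^ (i + r) • e) (t ^ i • y • e') = c i := by
  have hF : ∀ (i : ℕ) (a : A), (polarBilin Q (t ^ (i + r) • e) ∘ₗ orbitMap A (t ^ i • e')) a =
      polar Q (t ^ (i + r) • e) (t ^ i • a • e') := fun i a => by
    rw [smul_comm]; rfl
  obtain ⟨y, hy, hyc⟩ := exists_mem_span_forall_apply_eq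
    (fun i => polarBilin Q (t ^ (i + r) • e) ∘ₗ orbitMap (K := K) A (t ^ i • e'))
    -- The exponent makes the total power of `t` equal to `m - 1` on the diagonal and at least `m`
    -- for `j > i`; it is positive, so `t ∣ y`.
    (fun i => t ^ (2 * k - 1 - 2 * i)) k
    (fun i hi => by
      rw [hF, smul_smul, ← pow_add, H.polar_pow_smul_eq (n := m - 1) (by omega) (by omega)]
      exact hne)
    (fun i j hij hj => by
      rw [hF, smul_smul, ← pow_add, H.polar_pow_smul_eq_zero (by omega)]) c
  refine ⟨y, ?_, fun i hi => by rw [← hF]; exact hyc i hi⟩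
  have : Submodule.span K ((fun i => t ^ (2 * k - 1 - 2 * i)) '' Set.Iio k) ≤
      (Ideal.span {t}).restrictScalars K := by
    rw [Submodule.span_le]
    rintro _ ⟨i, hi, rfl⟩
    have hi' : i < k := hi
    exact Ideal.mem_span_singleton.mpr (dvd_pow_self t (by omega))
  exact Ideal.mem_span_singleton.mp (this hy)

/-- Elements with nonzero residue act invertibly. -/
theorem exists_mul_smul_eq (H : UnipotentAction Q st t m) {c : K} (hc : c ≠ 0) (b : A) :
    ∃ d, ∀ v : V, (d * (algebraMap K A c + t * b)) • v = v := by
  -- Geometric series: `c + t * b` divides `c ^ m - (-(t * b)) ^ m`, whose second term acts as zero.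
  obtain ⟨d, hd⟩ := sub_dvd_pow_sub_pow (algebraMap K A c) (-(t * b)) m
  rw [sub_neg_eq_add] at hd
  have hcc : algebraMap K A (c⁻¹ ^ m) * algebraMap K A c ^ m = 1 := by
    rw [← map_pow, ← map_mul, ← mul_pow, inv_mul_cancel₀ hc, one_pow, map_one]
  refine ⟨algebraMap K A (c⁻¹ ^ m) * d, fun v => ?_⟩
  rw [show algebraMap K A (c⁻¹ ^ m) * d * (algebraMap K A c + t * b) =
      1 - algebraMap K A (c⁻¹ ^ m) * (-(t * b)) ^ m by
    linear_combination hcc - algebraMap K A (c⁻¹ ^ m) * hd, sub_smul, one_smul,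
    H.smul_eq_zero_of_dvd, sub_zero]
  exact ⟨algebraMap K A (c⁻¹ ^ m) * (-b) ^ m, by rw [neg_mul_eq_mul_neg, mul_pow]; ring⟩

theorem pow_dvd_star_mul_sub (H : UnipotentAction Q st t m) {n : ℕ} {p p' : A} (hp : t ∣ p)
    (hp' : t ∣ p') (h : t ^ n ∣ p' - p) : t ^ (n + 1) ∣ p' * st p' - p * st p := by
  have e : p' * st p' - p * st p = (p' - p) * st p' + st (p' - p) * p := by
    rw [map_sub]; ring
  rw [e, pow_succ]
  refine dvd_add (mul_dvd_mul h ?_) (mul_dvd_mul (H.dvd_star h) hp)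
  simpa using H.dvd_star (n := 1) (by simpa using hp')

/-- The map `p ↦ -(y + p * st p * z)` is a `t`-adic contraction of the ideal `(t)` by
`pow_dvd_star_mul_sub`, so its iterates from `0` converge. -/
theorem exists_dvd_fixedPoint (H : UnipotentAction Q st t m) {y z : A} (hy : t ∣ y) (n : ℕ) :
    ∃ p, t ∣ p ∧ t ^ n ∣ p + y + p * st p * z := by
  induction n with
  | zero => exact ⟨0, by simp⟩
  | succ n ih =>
    obtain ⟨p, hp, hpn⟩ := ih
    have hp' : t ∣ -(y + p * st p * z) :=
      (dvd_add hy ((hp.mul_right _).mul_right _)).neg_right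
    refine ⟨-(y + p * st p * z), hp', ?_⟩
    have h := H.pow_dvd_star_mul_sub (n := n) hp hp' (by
      rw [show -(y + p * st p * z) - p = -(p + y + p * st p * z) by ring]; exact hpn.neg_right)
    refine (h.mul_right z).trans (dvd_of_eq ?_)
    ring

variable {k : ℕ}

theorem map_pow_smul_eq_zero (hQ : ∀ v : V, Q (t ^ k • v) = 0) {i : ℕ} (hi : k ≤ i) (v : V) : Q (t ^ i • v) = 0 := by
  obtain ⟨d, rfl⟩ := Nat.exists_eq_add_of_le hi
  rw [pow_add, mul_smul, hQ]

/-- The orbit form of `v` is represented by the pairing of the orbits of `e` and `e'`. -/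
theorem exists_dvd_forall_map_eq_polar (H : UnipotentAction Q st t (2 * k))
    (hQ : ∀ v : V, Q (t ^ k • v) = 0) {e e' : V}
    (hne : polar Q (t ^ (2 * k - 1) • e) e' ≠ 0) (v : V) :
    ∃ y, t ∣ y ∧ ∀ i : ℕ, Q (t ^ i • v) = polar Q (t ^ i • e) (t ^ i • y • e') := by
  obtain ⟨y, hy, h⟩ := H.exists_dvd_forall_polar_eq (k := k) (r := 0) rfl hne
    (fun i => Q (t ^ i • v))
  refine ⟨y, hy, fun i => ?_⟩
  rcases lt_or_ge i k with hi | hi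
  · exact (h i hi).symm
  · rw [map_pow_smul_eq_zero hQ hi, H.polar_pow_smul_eq_zero (by omega)]

/-- Representing the orbit forms of `e` and `e'` by `y` and `z`, one gets `Q (a • (e + p • e'))` as
the pairing of `a • e` with `a • (y + p * st p * z + p) • e'`; the fixed point `p` kills it. -/
theorem exists_isotropic_orbit (H : UnipotentAction Q st t (2 * k))
    (hQ : ∀ v : V, Q (t ^ k • v) = 0) {e e' : V}
    (hne : polar Q (t ^ (2 * k - 1) • e) e' ≠ 0) :
    ∃ p, t ∣ p ∧ ∀ a : A, Q (a • (e + p • e')) = 0 := by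
  obtain ⟨y, hy, hye⟩ := H.exists_dvd_forall_map_eq_polar hQ hne e
  obtain ⟨z, -, hze⟩ := H.exists_dvd_forall_map_eq_polar hQ hne e'
  obtain ⟨p, hp, hpm⟩ := H.exists_dvd_fixedPoint (z := z) hy (2 * k)
  refine ⟨p, hp, H.map_smul_eq_zero fun i => ?_⟩
  have h1 : Q (t ^ i • p • e') = polar Q (t ^ i • e) (t ^ i • (p * st p * z) • e') := by
    rw [smul_smul, H.map_smul_eq_polar hze, mul_comm, mul_smul, H.adjoint, smul_smul, smul_smul,
      smul_smul]
    congr 2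
    ring
  rw [smul_add, map_add_eq, hye, h1, ← polar_add_right, ← polar_add_right, ← smul_add, ← smul_add,
    ← add_smul, ← add_smul, H.smul_eq_zero_of_dvd (a := y + p * st p * z + p), smul_zero,
    polar_zero_right]
  convert hpm using 1
  ring

/-- A pair of generators with totally isotropic orbits, orthogonal to each other on the diagonal. -/
theorem exists_hyperbolic_generators (H : UnipotentAction Q st t (2 * k)) (hk : 1 ≤ k)
    (hQ : ∀ v : V, Q (t ^ k • v) = 0) {e e' : V}
    (hne : polar Q (t ^ (2 * k - 1) • e) e' ≠ 0) (hgen : ∀ v : V, ∃ a b : A, v = a • e + b • e') :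
    ∃ u w : V, polar Q (t ^ (2 * k - 1) • u) w ≠ 0 ∧ (∀ v : V, ∃ a b : A, v = a • u + b • w) ∧
      (∀ a : A, Q (a • u) = 0) ∧ (∀ a : A, Q (a • w) = 0) ∧
      ∀ a : A, polar Q (a • u) (a • w) = 0 := by
  obtain ⟨p, ⟨p, rfl⟩, hu⟩ := H.exists_isotropic_orbit hQ hne
  obtain ⟨u, hu_def⟩ : ∃ u, u = e + (t * p) • e' := ⟨_, rfl⟩
  rw [← hu_def] at hu
  have hn : 2 * k - 1 + 1 = 2 * k := by omega
  have hue : polar Q (t ^ (2 * k - 1) • u) e' ≠ 0 := by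
    have := H.polar_pow_smul_eq_zero (a := 2 * k - 1 + 1) (b := 0) (by omega) (p • e') e'
    rw [pow_zero, one_smul, pow_succ, mul_smul, smul_smul t] at this
    rwa [hu_def, smul_add, polar_add_left, this, add_zero]
  -- Rescaling `e'` by the unit `1 + t * y` cancels the diagonal pairings with `u`.
  obtain ⟨_, ⟨y, rfl⟩, hy⟩ := H.exists_dvd_forall_polar_eq (k := k) (r := 0) rfl hue
    (fun i => polar Q (t ^ i • u) (t ^ i • e'))
  simp only [add_zero] at hy
  obtain ⟨w₀, hw₀⟩ : ∃ w₀, w₀ = (1 + t * y) • e' := ⟨_, rfl⟩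
  have huw₀ : polar Q (t ^ (2 * k - 1) • u) w₀ ≠ 0 := by
    have := H.polar_pow_smul_algebraMap_add hn 1 y u e'
    rw [map_one, one_mul] at this
    rwa [hw₀, this]
  have hdiag₀ : ∀ i : ℕ, polar Q (t ^ i • u) (t ^ i • w₀) = 0 := by
    intro i
    rcases lt_or_ge i k with hi | hi
    · rw [hw₀, add_smul, one_smul, smul_add, polar_add_right, hy i hi, CharTwo.add_self_eq_zero]
    · exact H.polar_pow_smul_eq_zero (by omega) _ _
  -- Adding `(t * x) • u` cancels the orbit form of `w₀` and, since the orbit of `u` is totally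
  -- isotropic, leaves the pairings with `u` unchanged.
  obtain ⟨_, ⟨x, rfl⟩, hx⟩ := H.exists_dvd_forall_map_eq_polar hQ (e := w₀) (e' := u)
    (by rwa [polar_comm, ← H.polar_pow_smul_left hn]) w₀
  obtain ⟨w, hw⟩ : ∃ w, w = w₀ + (t * x) • u := ⟨_, rfl⟩
  have huu : ∀ a b : A, polar Q (a • u) (b • u) = 0 := fun a b => by
    rw [polar, ← add_smul, hu, hu, hu, sub_zero, sub_zero]
  refine ⟨u, w, ?_, ?_, hu, H.map_smul_eq_zero fun i => ?_,
    H.polar_smul_smul_eq_zero fun i => ?_⟩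
  · rwa [hw, polar_add_right, huu, add_zero]
  · intro v
    obtain ⟨d, hd⟩ := H.exists_mul_smul_eq one_ne_zero y
    rw [map_one] at hd
    have he' : e' = d • w - (d * (t * x)) • u := by
      rw [hw, smul_add, ← mul_smul, add_sub_cancel_right, hw₀, smul_smul, hd]
    obtain ⟨a, b, rfl⟩ := hgen v
    refine ⟨a - (b - a * (t * p)) * (d * (t * x)), (b - a * (t * p)) * d, ?_⟩
    have he : e = u - (t * p) • e' := by rw [hu_def, add_sub_cancel_right]
    rw [he, he']
    module
  · rw [hw, smul_add, map_add_eq, hx, smul_smul, hu, add_zero, CharTwo.add_self_eq_zero]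
  · rw [hw, smul_add, polar_add_right, hdiag₀, smul_smul, huu, add_zero]

end UnipotentAction

end QuadSpace

/-! ### Odd exponent: generators adapted to a square root. -/

namespace QuadSpace

/-- A Hensel type argument: solving `(ρ² + ραX + α²X) β = ρ + αX` modulo a power of `X`. -/
theorem exists_pow_dvd_norm_mul_add {K : Type*} [Field K] [CharP K 2] (α β : K[X])
    (hβ : β.coeff 0 ≠ 0) (n : ℕ) :
    ∃ ρ : K[X], ρ.coeff 0 ≠ 0 ∧
      X ^ n ∣ (ρ ^ 2 + ρ * α * X + α ^ 2 * X) * β + (ρ + α * X) := by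
  have two : (2 : K[X]) = 0 := algebra_two_eq_zero K K[X]
  suffices ∃ ρ : K[X], ρ.coeff 0 ≠ 0 ∧
      X ^ (n + 1) ∣ (ρ ^ 2 + ρ * α * X + α ^ 2 * X) * β + (ρ + α * X) by
    obtain ⟨ρ, h0, h⟩ := this
    exact ⟨ρ, h0, (pow_dvd_pow X n.le_succ).trans h⟩
  induction n with
  | zero =>
    -- Modulo `X` the equation is `ρ ^ 2 * β = ρ`, with nonzero root `1 / β(0)`.
    refine ⟨C (β.coeff 0)⁻¹, by simpa using hβ, ?_⟩
    rw [coeff_zero_eq_eval_zero] at hβ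
    rw [zero_add, pow_one, X_dvd_iff, coeff_zero_eq_eval_zero, coeff_zero_eq_eval_zero]
    simp only [eval_add, eval_mul, eval_pow, eval_C, eval_X, mul_zero, add_zero]
    field_simp
    linear_combination algebra_two_eq_zero K K
  | succ n ih =>
    obtain ⟨ρ, h0, d, hd⟩ := ih
    -- In characteristic 2 the derivative in `ρ` is `1` modulo `X`, so the Newton correction is the
    -- error itself.
    refine ⟨ρ + X ^ (n + 1) * d, ?_, X ^ n * d ^ 2 * β + d * α * β, ?_⟩
    · simpa [mul_coeff_zero, coeff_X_pow] using h0
    · linear_combination hd + (X ^ (n + 1) * d + X ^ (n + 1) * d * ρ * β) * two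

namespace UnipotentAction

open QuadraticMap

variable {K V A : Type*} [Field K] [CharP K 2] [AddCommGroup V] [Module K V] [CommRing A]
  [Algebra K A] [Module A V] [IsScalarTower K A V]
  {Q : QuadraticForm K V} {st : A →ₐ[K] A} {t : A} {k : ℕ}

theorem polar_norm_pow_smul {m : ℕ} (H : UnipotentAction Q st t m) (j : ℕ) (u w : V) :
    polar Q ((t * st t) ^ j • u) w = polar Q (t ^ j • u) (t ^ j • w) := by
  rw [mul_comm, mul_pow, mul_smul, H.adjoint, map_pow, H.star_star]

/-- With `N = t * st t = t + st t`, the norm of `p + q t` is `p² + p q N + q² N`. -/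
theorem exists_star_mul_self {m : ℕ} (H : UnipotentAction Q st t m) (a : A) :
    ∃ r : K[X], st a * a = aeval (t * st t) r := by
  obtain ⟨p, q, rfl⟩ := H.exists_eq a
  refine ⟨p ^ 2 + p * q * X + q ^ 2 * X, ?_⟩
  simp only [map_add, map_mul, map_pow, aeval_X, H.star_aeval]
  linear_combination (aeval (t * st t) p * aeval (t * st t) q) * H.add_star

theorem map_pow_smul_eq_zero_of_odd (H : UnipotentAction Q st t (2 * k + 1)) {i : ℕ} (hi : k < i)
    (v : V) : Q (t ^ i • v) = 0 := by
  obtain ⟨d, rfl⟩ := Nat.exists_eq_add_of_lt hi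
  rw [pow_succ', mul_smul, ← H.polar_self_smul, ← mul_smul, ← pow_succ',
    H.polar_pow_smul_eq_zero (by omega)]

/-- The orbit form of `v` is represented by the pairing of the orbits of `e` and `e'`. -/
theorem exists_forall_map_smul_eq_polar (H : UnipotentAction Q st t (2 * k + 1)) {e e' : V}
    (hne : polar Q (t ^ (2 * k) • e) e' ≠ 0) (v : V) :
    ∃ p : K[X], ∀ a : A, Q (a • v) = polar Q (a • e) (a • aeval (t * st t) p • e') := by
  let L (i : ℕ) : K[X] →ₗ[K] K := polarBilin Q (t ^ i • e) ∘ₗ orbitMap A (t ^ i • e') ∘ₗ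
    (aeval (t * st t)).toLinearMap
  have hL : ∀ (i : ℕ) (p : K[X]), L i p = polar Q (t ^ i • e) (t ^ i • aeval (t * st t) p • e') :=
    fun i p => by rw [smul_comm]; rfl
  have hpow : ∀ i j : ℕ, L i (X ^ j) = polar Q (t ^ (i + j) • e) (t ^ (i + j) • e') := by
    intro i j
    rw [hL, map_pow, aeval_X, smul_comm, polar_comm, H.polar_norm_pow_smul, polar_comm, smul_smul,
      smul_smul, ← pow_add, add_comm]
  -- By `hpow`, `X ^ j` raises the power of `t` on both sides by `j`, so row `i` hits the residue
  -- form at `j = k - i`.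
  obtain ⟨p, -, hp⟩ := exists_mem_span_forall_apply_eq L (fun i => X ^ (k - i)) (k + 1)
    (fun i hi => by
      rw [hpow, H.polar_pow_smul_eq rfl (by omega)]
      exact hne)
    (fun i j hij hj => by
      rw [hpow, H.polar_pow_smul_eq_zero (by omega)]) (fun i => Q (t ^ i • v))
  refine ⟨p, H.map_smul_eq_polar fun i => ?_⟩
  rw [← hL]
  rcases lt_or_ge i (k + 1) with hi | hi
  · exact (hp i hi).symm
  · rw [H.map_pow_smul_eq_zero_of_odd (by omega), hL, H.polar_pow_smul_eq_zero (by omega)]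

/-- After this normalization the functional `c ↦ polar Q e (c • e')` kills `st t` times every
polynomial in the norm (`polar_star_mul_aeval`). -/
theorem exists_normalized_generator (H : UnipotentAction Q st t (2 * k + 1)) {e e' : V}
    (hne : polar Q (t ^ (2 * k) • e) e' ≠ 0) :
    ∃ y : A, t ∣ y ∧
      ∀ i : ℕ, polar Q (t ^ (i + 1) • e) (t ^ i • (1 + y) • e') = 0 := by
  obtain ⟨y, hy, h⟩ := H.exists_dvd_forall_polar_eq (k := k) (r := 1) rfl hne
    (fun i => polar Q (t ^ (i + 1) • e) (t ^ i • e'))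
  refine ⟨y, hy, fun i => ?_⟩
  rcases lt_or_ge i k with hi | hi
  · rw [add_smul, one_smul, smul_add, polar_add_right, h i hi, CharTwo.add_self_eq_zero]
  · exact H.polar_pow_smul_eq_zero (by omega) _ _

theorem polar_star_mul_aeval (H : UnipotentAction Q st t (2 * k + 1)) {e e' : V}
    (hnorm : ∀ i : ℕ, polar Q (t ^ (i + 1) • e) (t ^ i • e') = 0) (p : K[X]) :
    polar Q e ((st t * aeval (t * st t) p) • e') = 0 := by
  induction p using Polynomial.induction_on' with
  | add p q hp hq => rw [map_add, mul_add, add_smul, polar_add_right, hp, hq, add_zero]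
  | monomial j c =>
    have := hnorm j
    rw [pow_succ, mul_smul, ← H.polar_norm_pow_smul, H.adjoint, H.adjoint, map_pow, H.star_norm,
      smul_smul] at this
    rw [aeval_monomial, ← Algebra.smul_def, mul_smul_comm, smul_assoc, polar_smul_right, this,
      smul_zero]

/-- Generators `e`, `w` such that `e ↦ e + w`, `w ↦ t • e + w` extends to an isometry. -/
theorem exists_sqrt_generators (H : UnipotentAction Q st t (2 * k + 1)) {e e' : V}
    (hne : polar Q (t ^ (2 * k) • e) e' ≠ 0) (hgen : ∀ v : V, ∃ a b : A, v = a • e + b • e')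
    (hq : Q (t ^ k • e') ≠ 0) :
    ∃ w : V, polar Q (t ^ (2 * k) • e) w ≠ 0 ∧ (∀ v : V, ∃ a b : A, v = a • e + b • w) ∧
      (∀ a : A, Q (a • w) = polar Q (a • e) (a • w)) ∧
      (∀ a : A, Q ((a * t) • e) = polar Q ((a * t) • e) (a • w)) ∧
      ∀ a b : A, polar Q (a • e) ((b * t) • e) + polar Q (a • w) ((b * t) • e) +
        polar Q (a • w) (b • w) = 0 := by
  have two : (2 : A) = 0 := algebra_two_eq_zero K A
  obtain ⟨_, ⟨y₀, rfl⟩, hnorm⟩ := H.exists_normalized_generator hne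
  obtain ⟨w₀, hw₀⟩ : ∃ w₀, w₀ = (1 + t * y₀) • e' := ⟨_, rfl⟩
  rw [← hw₀] at hnorm
  have hne₀ : polar Q (t ^ (2 * k) • e) w₀ ≠ 0 := by
    have := H.polar_pow_smul_algebraMap_add rfl 1 y₀ e e'
    rw [map_one, one_mul] at this
    rwa [hw₀, this]
  have hq₀ : Q (t ^ k • w₀) ≠ 0 := by
    rw [hw₀, add_smul, one_smul, smul_add, map_add_eq, mul_smul, smul_smul (t ^ k) t, ← pow_succ,
      H.map_pow_smul_eq_zero_of_odd (i := k + 1) (by omega), H.polar_pow_smul_eq_zero (by omega),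
      add_zero, add_zero]
    exact hq
  obtain ⟨α, hα⟩ := H.exists_forall_map_smul_eq_polar hne₀ e
  obtain ⟨β, hβ⟩ := H.exists_forall_map_smul_eq_polar hne₀ w₀
  have hβ0 : β.coeff 0 ≠ 0 := by
    intro h0
    obtain ⟨β, rfl⟩ := X_dvd_iff.mpr h0
    refine hq₀ ?_
    rw [hβ, map_mul, aeval_X, mul_assoc, mul_smul, smul_smul (t ^ k) t, ← pow_succ,
      H.polar_pow_smul_eq_zero (by omega)]
  -- The generator sought is `w = (r + t x) • w₀` with `r = ρ(N)`, `x = α(N)`, `N = t * st t`. The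
  -- factor `r + t x` has norm `r² + r x N + x² N`, so `hρ` says that its norm times `β(N)` is `r +
  -- N x`; this differs from `r + t x` by `x * st t`, which `G` ignores after multiplication by
  -- norms. Precision `k + 1` suffices since `t ^ (2k + 2)` divides `N ^ (k + 1)`.
  obtain ⟨ρ, hρ0, hρ⟩ := exists_pow_dvd_norm_mul_add α β hβ0 (k + 1)
  obtain ⟨G, hG⟩ : ∃ G : A →ₗ[K] K, ∀ c, G c = polar Q e (c • w₀) :=
    ⟨polarBilin Q e ∘ₗ orbitMap A w₀, fun _ => rfl⟩
  have hGG : ∀ a b, polar Q (a • e) (b • w₀) = G (st a * b) := fun a b => by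
    rw [H.polar_smul_smul, hG]
  have hGs : ∀ p : K[X], G (st t * aeval (t * st t) p) = 0 := fun p => by
    rw [hG, H.polar_star_mul_aeval hnorm]
  have hα' : ∀ a, Q (a • e) = G (st a * a * aeval (t * st t) α) := fun a => by
    rw [hα, smul_smul, hGG, mul_assoc]
  have hβ' : ∀ a, Q (a • w₀) = G (st a * a * aeval (t * st t) β) := fun a => by
    rw [hβ, smul_smul, hGG, mul_assoc]
  obtain ⟨r, hr⟩ : ∃ r, r = aeval (t * st t) ρ := ⟨_, rfl⟩
  obtain ⟨x, hx⟩ : ∃ x, x = aeval (t * st t) α := ⟨_, rfl⟩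
  obtain ⟨z, hz⟩ : ∃ z, z = aeval (t * st t) β := ⟨_, rfl⟩
  have hsr : st r = r := by rw [hr, H.star_aeval]
  have hsx : st x = x := by rw [hx, H.star_aeval]
  have hGa : ∀ a s, G (st a * a * (st t * aeval (t * st t) s)) = 0 := fun a s => by
    obtain ⟨p, hp⟩ := H.exists_star_mul_self a
    rw [hp, mul_left_comm, ← map_mul, hGs]
  -- For `c = p + q t` the bracket is `st t * (p + q N)` in characteristic 2.
  have hGc : ∀ c, G ((c + (1 + st t) * st c) * r) = 0 := fun c => by
    obtain ⟨p, q, rfl⟩ := H.exists_eq c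
    have := hGs ((p + q * X) * ρ)
    rw [← this, hr]
    congr 1
    simp only [map_add, map_mul, aeval_X, H.star_aeval]
    linear_combination (aeval (t * st t) p * aeval (t * st t) ρ) * two +
      (aeval (t * st t) q * aeval (t * st t) ρ * (1 + st t)) * H.add_star
  have hnormy : ∀ a, G (a * ((r + t * x) * st (r + t * x) * z)) = G (a * (r + t * st t * x)) := by
    intro a
    rw [← sub_eq_zero, ← map_sub, hG]
    refine (congrArg (polar Q e) (H.smul_eq_zero_of_dvd ?_ w₀)).trans (polar_zero_right _ _)
    have h1 : t ^ (2 * k + 1) ∣ (t * st t) ^ (k + 1) := by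
      have : t ^ 2 ∣ t * st t := by
        rw [pow_two]
        exact mul_dvd_mul_left t (by simpa using H.dvd_star (n := 1) (a := t) (by simp))
      refine (pow_dvd_pow t (show 2 * k + 1 ≤ 2 * (k + 1) by omega)).trans ?_
      rw [pow_mul]
      exact pow_dvd_pow_of_dvd this _
    have h2 : (t * st t) ^ (k + 1) ∣
        (r ^ 2 + r * x * (t * st t) + x ^ 2 * (t * st t)) * z + (r + x * (t * st t)) := by
      have := map_dvd (aeval (t * st t)) hρ
      simpa only [map_add, map_mul, map_pow, aeval_X, ← hr, ← hx, ← hz] using this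
    refine ((h1.trans h2).mul_left a).trans (dvd_of_eq ?_)
    rw [map_add, map_mul, hsr, hsx]
    linear_combination (-a * r * x * z) * H.add_star + (a * (r + t * st t * x)) * two
  have hC1 : ∀ a, Q (a • (r + t * x) • w₀) = G (st a * a * (r + t * x)) := by
    intro a
    rw [smul_smul, hβ', ← hz, map_mul st,
      show st a * st (r + t * x) * (a * (r + t * x)) * z =
        st a * a * ((r + t * x) * st (r + t * x) * z) by ring, hnormy]
    have := hGa a α
    rw [← hx] at this
    rw [← sub_eq_zero, ← map_sub, ← this]
    congr 1
    linear_combination (-st a * a * x) * H.add_star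
  have hyres : r + t * x =
      algebraMap K A (ρ.coeff 0) + t * (st t * aeval (t * st t) ρ.divX + x) := by
    rw [hr]
    conv_lhs => rw [← Polynomial.divX_mul_X_add ρ]
    simp only [map_add, map_mul, aeval_X, aeval_C]
    ring
  refine ⟨(r + t * x) • w₀, ?_, ?_, ?_, ?_, ?_⟩
  · rw [hyres, H.polar_pow_smul_algebraMap_add rfl]
    exact mul_ne_zero hρ0 hne₀
  · intro v
    obtain ⟨d, hd⟩ := H.exists_mul_smul_eq hρ0 (st t * aeval (t * st t) ρ.divX + x)
    obtain ⟨d', hd'⟩ := H.exists_mul_smul_eq one_ne_zero y₀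
    rw [← hyres] at hd
    rw [map_one] at hd'
    obtain ⟨a, b, rfl⟩ := hgen v
    refine ⟨a, b * d' * d, ?_⟩
    rw [mul_smul _ d, smul_smul d, hd, hw₀, mul_smul b, smul_smul d', hd']
  · intro a
    rw [hC1, smul_smul, hGG, mul_assoc]
  · intro a
    rw [hα', smul_smul, hGG, ← hx, map_mul st]
    have := hGa a ρ
    rw [← hr] at this
    rw [← sub_eq_zero, ← map_sub, ← neg_eq_zero, ← map_neg, ← this]
    congr 1
    ring
  · intro a b
    have h1 : ∀ a b, polar Q (a • e) (b • e) = G ((st a * b + st b * a) * x) := fun a b => by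
      rw [polar, ← add_smul, hα', hα', hα', ← map_sub, ← map_sub, map_add, ← hx]
      congr 1
      ring
    have h2 : ∀ a b, polar Q (a • (r + t * x) • w₀) (b • (r + t * x) • w₀) =
        G ((st a * b + st b * a) * (r + t * x)) := fun a b => by
      rw [polar, ← add_smul, hC1, hC1, hC1, ← map_sub, ← map_sub, map_add]
      congr 1
      ring
    have hstst : st (st a * b) = st b * a := by
      obtain ⟨p, q, rfl⟩ := H.exists_eq a
      simp only [map_mul, map_add, H.star_aeval, H.star_star]
      ring
    rw [h1, h2, polar_comm, smul_smul, hGG, ← map_add, ← map_add, ← hGc (st a * b), hstst]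
    congr 1
    simp only [map_mul]
    linear_combination (st b * a * x) * H.add_star + (st a * b * t * x + st b * a * x * t * st t) * two

end UnipotentAction

end QuadSpace

/-! ### Cyclic submodules, maps defined on generators, and the obstruction to square roots. -/

namespace QuadSpace

namespace UnipotentAction

open QuadraticMap

variable {K V A : Type*} [Field K] [CharP K 2] [AddCommGroup V] [Module K V] [CommRing A]
  [Algebra K A] [Module A V] [IsScalarTower K A V]
  {Q : QuadraticForm K V} {st : A →ₐ[K] A} {t : A} {m : ℕ}

section Cyclic

/-- The orbit of a vector anisotropic for the residue form is nondegenerate: pairing with `t ^ (n -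
j) • v` isolates the residue of `a / t ^ j`, so factors `t` split off one by one. -/
theorem smul_eq_zero_of_forall_polar (H : UnipotentAction Q st t m) {n : ℕ} (h : n + 1 = m) {v : V}
    (hv : polar Q (t ^ n • v) v ≠ 0) {a : A} (ha : ∀ b : A, polar Q (b • v) (a • v) = 0) :
    a • v = 0 := by
  suffices ∀ j ≤ m, t ^ j ∣ a from H.smul_eq_zero_of_dvd (this m le_rfl) v
  intro j
  induction j with
  | zero => simp
  | succ j ih =>
    intro hj
    obtain ⟨a', rfl⟩ := ih (by omega)
    obtain ⟨c, b, rfl⟩ := H.exists_residue a'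
    have := ha (t ^ (n - j))
    rw [mul_smul, H.polar_pow_smul_eq h (by omega), H.polar_pow_smul_algebraMap_add h] at this
    rw [(mul_eq_zero.mp this).resolve_right hv, map_zero, zero_add, ← mul_assoc, ← pow_succ]
    exact dvd_mul_right _ _

theorem finrank_range_orbitMap_le (H : UnipotentAction Q st t m) (v : V) :
    Module.finrank K (LinearMap.range (orbitMap (K := K) A v)) ≤ m := by
  have hle : LinearMap.range (orbitMap (K := K) A v) ≤
      Submodule.span K (Set.range fun i : Fin m => t ^ (i : ℕ) • v) := by
    rintro _ ⟨a, rfl⟩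
    obtain ⟨p, hp⟩ := H.exists_smul_eq_aeval a
    rw [orbitMap_apply, hp]
    clear hp
    induction p using Polynomial.induction_on' with
    | add p q hp hq => rw [map_add, add_smul]; exact add_mem hp hq
    | monomial i c =>
      rw [aeval_monomial, ← Algebra.smul_def, smul_assoc]
      refine Submodule.smul_mem _ _ ?_
      rcases lt_or_ge i m with hi | hi
      · exact Submodule.subset_span ⟨⟨i, hi⟩, rfl⟩
      · rw [H.pow_smul_of_le hi]
        exact zero_mem _
  have hfin : Module.Finite K (Submodule.span K (Set.range fun i : Fin m => t ^ (i : ℕ) • v)) :=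
    FiniteDimensional.span_of_finite K (Set.finite_range _)
  refine (Submodule.finrank_mono hle).trans ?_
  simpa [Set.finrank] using finrank_range_le_card (R := K) (fun i : Fin m => t ^ (i : ℕ) • v)

end Cyclic

section Generators

variable {e e' : V}

/-- Otherwise the residue form vanishes on both generators and `t ^ n V` lies in the radical of the
polar form. -/
theorem polar_pow_smul_ne_zero (H : UnipotentAction Q st t m) {n : ℕ} (h : n + 1 = m)
    (hnd : ∀ v, (∀ w, polar Q v w = 0) → v = 0) (halt : ∀ v, polar Q (t ^ n • v) v = 0)
    (hgen : ∀ v : V, ∃ a b : A, v = a • e + b • e') (hn : ∃ v : V, t ^ n • v ≠ 0) :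
    polar Q (t ^ n • e) e' ≠ 0 := by
  intro h0
  have h0' : polar Q (t ^ n • e') e = 0 := by rw [polar_comm, ← H.polar_pow_smul_left h, h0]
  have key : ∀ u, polar Q (t ^ n • u) e = 0 → polar Q (t ^ n • u) e' = 0 → t ^ n • u = 0 := by
    intro u hu hu'
    refine hnd _ fun w => ?_
    obtain ⟨a, b, rfl⟩ := hgen w
    obtain ⟨c, a, rfl⟩ := H.exists_residue a
    obtain ⟨d, b, rfl⟩ := H.exists_residue b
    rw [polar_add_right, H.polar_pow_smul_algebraMap_add h, H.polar_pow_smul_algebraMap_add h,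
      hu, hu', mul_zero, mul_zero, add_zero]
  obtain ⟨v, hv⟩ := hn
  obtain ⟨a, b, rfl⟩ := hgen v
  refine hv ?_
  rw [smul_add, smul_comm _ a, smul_comm _ b, key e (halt e) h0, key e' h0' (halt e'), smul_zero,
    smul_zero, add_zero]

/-- `A`-linear maps may be prescribed on independent generators. -/
theorem exists_linearMap_of_generators (H : UnipotentAction Q st t m) {n : ℕ} (h : n + 1 = m)
    (halt : ∀ v, polar Q (t ^ n • v) v = 0) (hne : polar Q (t ^ n • e) e' ≠ 0)
    (hgen : ∀ v : V, ∃ a b : A, v = a • e + b • e') (x y : V) :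
    ∃ g : V →ₗ[K] V, ∀ a b : A, g (a • e + b • e') = a • x + b • y := by
  obtain ⟨s, hs⟩ := LinearMap.exists_rightInverse_of_surjective
    ((orbitMap (K := K) A e).coprod (orbitMap (K := K) A e')) (LinearMap.range_eq_top.mpr fun v => by
      obtain ⟨a, b, rfl⟩ := hgen v
      exact ⟨(a, b), by simp⟩)
  refine ⟨(orbitMap (K := K) A x).coprod (orbitMap (K := K) A y) ∘ₗ s, fun a b => ?_⟩
  have hsab := LinearMap.congr_fun hs (a • e + b • e')
  simp only [LinearMap.comp_apply, LinearMap.coprod_apply, orbitMap_apply, LinearMap.id_apply] at *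
  obtain ⟨h1, h2⟩ := H.pow_dvd_of_smul_add_smul h halt hne
    (a := (s (a • e + b • e')).1 - a) (b := (s (a • e + b • e')).2 - b) (by
      rw [sub_smul, sub_smul, ← sub_eq_zero.mpr hsab]
      abel)
  have e1 := H.smul_eq_zero_of_dvd h1 x
  have e2 := H.smul_eq_zero_of_dvd h2 y
  rw [sub_smul, sub_eq_zero] at e1 e2
  rw [e1, e2]

theorem isCompl_range_orbitMap (H : UnipotentAction Q st t m) {n : ℕ} (h : n + 1 = m)
    (halt : ∀ v, polar Q (t ^ n • v) v = 0) (hne : polar Q (t ^ n • e) e' ≠ 0)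
    (hgen : ∀ v : V, ∃ a b : A, v = a • e + b • e') :
    IsCompl (LinearMap.range (orbitMap (K := K) A e)) (LinearMap.range (orbitMap (K := K) A e')) := by
  constructor
  · rw [Submodule.disjoint_def]
    rintro _ ⟨a, rfl⟩ ⟨b, hb⟩
    refine H.smul_eq_zero_of_dvd (H.pow_dvd_of_smul_add_smul h halt hne (a := a) (b := -b) ?_).1 e
    rw [orbitMap_apply, orbitMap_apply] at hb
    rw [neg_smul, hb, add_neg_cancel]
  · rw [codisjoint_iff, eq_top_iff]
    intro v _
    obtain ⟨a, b, rfl⟩ := hgen v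
    exact Submodule.add_mem_sup ⟨a, rfl⟩ ⟨b, rfl⟩

/-- A semisimple isometry of order three commuting with the action. -/
theorem exists_isometry_order_three (H : UnipotentAction Q st t m) {n : ℕ} (h : n + 1 = m)
    (halt : ∀ v, polar Q (t ^ n • v) v = 0) (hne : polar Q (t ^ n • e) e' ≠ 0)
    (hgen : ∀ v : V, ∃ a b : A, v = a • e + b • e')
    (he : ∀ a : A, Q (a • e) = 0) (he' : ∀ a : A, Q (a • e') = 0)
    (hee' : ∀ a : A, polar Q (a • e) (a • e') = 0) :
    ∃ g : V →ₗ[K] V, (∀ a : A, g (a • e) = a • e') ∧ (∀ v, g (g v) + g v + v = 0) ∧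
      (∀ v, Q (g v) = Q v) ∧ ∀ (a : A) v, g (a • v) = a • g v := by
  obtain ⟨g, hg⟩ := H.exists_linearMap_of_generators h halt hne hgen e' (e + e')
  have two : (2 : A) = 0 := algebra_two_eq_zero K A
  have hg' : ∀ a b : A, g (a • e + b • e') = b • e + (a + b) • e' := fun a b => by
    rw [hg]; module
  refine ⟨g, fun a => ?_, fun v => ?_, fun v => ?_, fun a v => ?_⟩
  · simpa using hg a 0
  · obtain ⟨a, b, rfl⟩ := hgen v
    rw [hg', hg', show (a + b) • e + (b + (a + b)) • e' + (b • e + (a + b) • e') +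
      (a • e + b • e') = (2 : A) • ((a + b) • e + (a + 2 * b) • e') by module, two, zero_smul]
  · obtain ⟨a, b, rfl⟩ := hgen v
    -- Polarizing the diagonal condition gives `f(a e, b e') = f(b e, a e')`, which is invariance of
    -- `Q` under `g`.
    have := hee' (a + b)
    rw [add_smul, add_smul, polar_add_left, polar_add_right, polar_add_right, hee', hee', zero_add,
      add_zero, CharTwo.add_eq_zero] at this
    rw [hg', map_add_eq, map_add_eq, he, he, he', he', this, add_smul, polar_add_right, hee']
    simp
  · obtain ⟨b, c, rfl⟩ := hgen v
    rw [smul_add, smul_smul, smul_smul, hg, hg]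
    module

/-- A square root of the action of `1 + t`. -/
theorem exists_isometry_sq (H : UnipotentAction Q st t m) {n : ℕ} (h : n + 1 = m)
    (halt : ∀ v, polar Q (t ^ n • v) v = 0) (hne : polar Q (t ^ n • e) e' ≠ 0)
    (hgen : ∀ v : V, ∃ a b : A, v = a • e + b • e')
    (h1 : ∀ a : A, Q (a • e') = polar Q (a • e) (a • e'))
    (h2 : ∀ a : A, Q ((a * t) • e) = polar Q ((a * t) • e) (a • e'))
    (h3 : ∀ a b : A, polar Q (a • e) ((b * t) • e) + polar Q (a • e') ((b * t) • e) +
        polar Q (a • e') (b • e') = 0) :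
    ∃ g : V →ₗ[K] V, (∀ v, g (g v) = (1 + t) • v) ∧ ∀ v, Q (g v) = Q v := by
  -- `g = 1 + s` with `s e = e'`, `s e' = t e`; so `s² = t` and `g² = 1 + t` in characteristic 2.
  obtain ⟨g, hg⟩ := H.exists_linearMap_of_generators h halt hne hgen (e + e') (t • e + e')
  have two : (2 : A) = 0 := algebra_two_eq_zero K A
  have hg' : ∀ a b : A, g (a • e + b • e') = (a + b * t) • e + (a + b) • e' := fun a b => by
    rw [hg]; module
  refine ⟨g, fun v => ?_, fun v => ?_⟩
  · obtain ⟨a, b, rfl⟩ := hgen v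
    rw [hg', hg']
    rw [show (a + b * t + (a + b) * t) • e + (a + b * t + (a + b)) • e' =
      (1 + t) • (a • e + b • e') + (2 : A) • ((b * t) • e + a • e') by module, two, zero_smul,
      add_zero]
  · obtain ⟨a, b, rfl⟩ := hgen v
    have two' : (2 : K) = 0 := algebra_two_eq_zero K K
    rw [hg', map_add_eq, map_add_eq, add_smul, add_smul, map_add_eq, map_add_eq, h2, h1, h1 b,
      polar_add_left, polar_add_right, polar_add_right]
    linear_combination h3 a b + polar_comm Q ((b * t) • e) (a • e') +
      (polar Q ((b * t) • e) (b • e') + polar Q (a • e) (a • e')) * two'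

theorem eq_zero_of_sq_eq (H : UnipotentAction Q st t m) {n : ℕ} (h : n + 1 = m)
    (halt : ∀ v, polar Q (t ^ n • v) v = 0) (hne : polar Q (t ^ n • e) e' ≠ 0)
    (hgen : ∀ v : V, ∃ a b : A, v = a • e + b • e') {s : V →ₗ[K] V}
    (hs : ∀ v, s (s v) = t • v) (hst : ∀ v, s (t • v) = t • s v)
    (hs0 : ∀ v, polar Q (t ^ n • v) (s v) = 0) (v : V) : t • v = 0 := by
  have hne' : polar Q (t ^ n • e') e ≠ 0 := by
    rwa [polar_comm, ← H.polar_pow_smul_left h]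
  have hgen' : ∀ v : V, ∃ (c d : K) (x : V), v = c • e + d • e' + t • x := by
    intro v
    obtain ⟨a, b, rfl⟩ := hgen v
    obtain ⟨c, a, rfl⟩ := H.exists_residue a
    obtain ⟨d, b, rfl⟩ := H.exists_residue b
    refine ⟨c, d, a • e + b • e', ?_⟩
    rw [← algebraMap_smul A c, ← algebraMap_smul A d]
    module
  have hpol : ∀ (u : V) (c d : K) (x : V), polar Q (t ^ n • u) (c • e + d • e' + t • x) =
      c * polar Q (t ^ n • u) e + d * polar Q (t ^ n • u) e' := by
    intro u c d x
    have := H.polar_pow_smul_eq_zero (a := n) (b := 1) (by omega) u x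
    rw [pow_one] at this
    rw [polar_add_right, polar_add_right, this, add_zero, polar_smul_right, polar_smul_right,
      smul_eq_mul, smul_eq_mul]
  -- An eigenvalue of `s` modulo `t` satisfies `c² = 0`, because `s² = t`.
  have heig : ∀ (u u' : V) (c : K) (x : V), polar Q (t ^ n • u') u ≠ 0 → s u = c • u + t • x →
      s u = t • x := by
    intro u u' c x hu hsu
    have h1 := hs u
    rw [hsu, map_add, map_smul, hsu, hst, ← sub_eq_zero,
      show c • (c • u + t • x) + t • s x - t • u =
        (c * c) • u + t • (c • x + s x - u) by
          rw [smul_add c, smul_smul, smul_sub, smul_add t, smul_comm c t]; abel] at h1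
    have h2 := H.polar_pow_smul_eq_zero (a := n) (b := 1) (by omega) u' (c • x + s x - u)
    have h3 : polar Q (t ^ n • u') ((c * c) • u + t • (c • x + s x - u)) = 0 := by
      rw [h1, polar_zero_right]
    rw [pow_one] at h2
    rw [polar_add_right, h2, add_zero, polar_smul_right, smul_eq_mul] at h3
    have hc : c = 0 := by simpa using (mul_eq_zero.mp h3).resolve_right hu
    rw [hsu, hc, zero_smul, zero_add]
  obtain ⟨x, hx⟩ : ∃ x, s e = t • x := by
    obtain ⟨c, d, x, hx⟩ := hgen' (s e)
    have := hs0 e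
    rw [hx, hpol, halt, mul_zero, zero_add] at this
    rw [(mul_eq_zero.mp this).resolve_right hne, zero_smul, add_zero] at hx
    exact ⟨x, heig e e' c x hne' hx⟩
  obtain ⟨x', hx'⟩ : ∃ x, s e' = t • x := by
    obtain ⟨c, d, x, hx⟩ := hgen' (s e')
    have := hs0 e'
    rw [hx, hpol, halt, mul_zero, add_zero] at this
    rw [(mul_eq_zero.mp this).resolve_right hne', zero_smul, zero_add] at hx
    exact ⟨x, heig e' e d x hne hx⟩
  have hsub : ∀ v, ∃ w, s v = t • w := by
    intro v
    obtain ⟨c, d, y, rfl⟩ := hgen' v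
    refine ⟨c • x + d • x' + s y, ?_⟩
    rw [map_add, map_add, map_smul, map_smul, hx, hx', hst, smul_add, smul_add, smul_comm t c,
      smul_comm t d]
  have hpow : ∀ j : ℕ, ∀ v, ∃ w, s v = t ^ j • s w := by
    intro j
    induction j with
    | zero => exact fun v => ⟨v, by simp⟩
    | succ j ih =>
      intro v
      obtain ⟨w, hw⟩ := ih v
      obtain ⟨x, hx⟩ := hsub w
      obtain ⟨y, hy⟩ := hsub x
      refine ⟨y, ?_⟩
      rw [hw, hx, ← hs, hy, hst, smul_smul, pow_succ]
  obtain ⟨w, hw⟩ := hpow m (s v)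
  rw [← hs, hw, H.pow_smul]

end Generators

end UnipotentAction

end QuadSpace

/-! ### Laurent polynomials in an isometry. -/

namespace QuadSpace

open QuadraticMap LaurentPolynomial

variable {K V : Type*} [Field K] [AddCommGroup V] [Module K V]

section Laurent

/-- The action of Laurent polynomials in `φ`. -/
noncomputable def laurentHom (φ : V ≃ₗ[K] V) : K[T;T⁻¹] →ₐ[K] Module.End K V :=
  AddMonoidAlgebra.lift K (Module.End K V) ℤ
    (LinearEquiv.automorphismGroup.toLinearMapMonoidHom.comp (zpowersHom (V ≃ₗ[K] V) φ))

theorem laurentHom_T (φ : V ≃ₗ[K] V) (n : ℤ) (v : V) : laurentHom φ (T n) v = (φ ^ n) v := by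
  rw [laurentHom, T, AddMonoidAlgebra.lift_single, one_smul]
  rfl

noncomputable abbrev laurentModule (φ : V ≃ₗ[K] V) : Module K[T;T⁻¹] V :=
  Module.compHom V (laurentHom φ).toRingHom

theorem isScalarTower_laurentModule (φ : V ≃ₗ[K] V) :
    letI := laurentModule φ
    IsScalarTower K K[T;T⁻¹] V := by
  let _ := laurentModule φ
  refine ⟨fun c a v => ?_⟩
  change laurentHom φ (c • a) v = c • laurentHom φ a v
  rw [map_smul, LinearMap.smul_apply]

theorem T_one_sub_one_pow_smul (φ : V ≃ₗ[K] V) (n : ℕ) (v : V) :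
    letI := laurentModule φ
    ((T 1 - 1 : K[T;T⁻¹]) ^ n) • v = ((toEnd φ - 1) ^ n) v := by
  let _ := laurentModule φ
  change laurentHom φ ((T 1 - 1) ^ n) v = _
  have : laurentHom φ (T 1 - 1) = toEnd φ - 1 := by
    ext v
    rw [map_sub, map_one, LinearMap.sub_apply, laurentHom_T, zpow_one]
    rfl
  rw [map_pow, this]

variable [CharP K 2]

/-- With `N` the norm of `t = T 1 - 1`, one has `t² = N t + N`, so `K[N] + K[N] t` is stable under
`T 1 = 1 + t` and `T (-1) = 1 + t + N`. -/
theorem exists_eq_aeval_add_aeval_mul (a : K[T;T⁻¹]) :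
    ∃ p q : K[X], a = aeval ((T 1 - 1) * (T (-1) - 1) : K[T;T⁻¹]) p +
      aeval ((T 1 - 1) * (T (-1) - 1) : K[T;T⁻¹]) q * (T 1 - 1) := by
  have two : (2 : K[T;T⁻¹]) = 0 := algebra_two_eq_zero K _
  have hTT : (T 1 * T (-1) : K[T;T⁻¹]) = 1 := by rw [← T_add]; simp
  induction a using LaurentPolynomial.induction_on with
  | h_C c => exact ⟨Polynomial.C c, 0, by
      rw [map_zero, zero_mul, add_zero, aeval_C, LaurentPolynomial.C_eq_algebraMap]⟩
  | h_add hp hq =>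
    obtain ⟨p, q, rfl⟩ := hp
    obtain ⟨p', q', rfl⟩ := hq
    refine ⟨p + p', q + q', ?_⟩
    rw [map_add, map_add]
    ring
  | h_C_mul_T n c h =>
    obtain ⟨p, q, h⟩ := h
    refine ⟨p - X * q, p + q + X * q, ?_⟩
    rw [T_add, ← mul_assoc, h]
    simp only [map_add, map_sub, map_mul, aeval_X]
    generalize aeval ((T 1 - 1) * (T (-1) - 1) : K[T;T⁻¹]) p = P
    generalize aeval ((T 1 - 1) * (T (-1) - 1) : K[T;T⁻¹]) q = R
    linear_combination (-R * (T 1 - 1)) * hTT + R * (T 1 - 1) * (T 1 + T (-1) - 2) * two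
  | h_C_mul_T_Z n c h =>
    obtain ⟨p, q, h⟩ := h
    refine ⟨p + X * p + X * q, -p + q, ?_⟩
    rw [sub_eq_add_neg, T_add, ← mul_assoc, h]
    simp only [map_add, map_neg, map_mul, aeval_X]
    generalize aeval ((T 1 - 1) * (T (-1) - 1) : K[T;T⁻¹]) p = P
    generalize aeval ((T 1 - 1) * (T (-1) - 1) : K[T;T⁻¹]) q = R
    linear_combination (-P) * hTT + P * (T 1 + T (-1) - 2) * two

theorem unipotentAction_laurent {Q : QuadraticForm K V} (φ : O Q) {m : ℕ}
    (hm : (toEnd φ.1 - 1) ^ m = 0) :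
    letI := laurentModule φ.1
    UnipotentAction Q (invert (R := K) : K[T;T⁻¹] →ₐ[K] K[T;T⁻¹]) (T 1 - 1) m := by
  let _ := laurentModule φ.1
  have two : (2 : K[T;T⁻¹]) = 0 := algebra_two_eq_zero K _
  have hTT : (T 1 * T (-1) : K[T;T⁻¹]) = 1 := by rw [← T_add]; simp
  have hst : (invert (R := K) : K[T;T⁻¹] →ₐ[K] K[T;T⁻¹]) (T 1 - 1) = T (-1) - 1 := by simp
  constructor
  · intro v
    rw [add_sub_cancel]
    change Q (laurentHom φ.1 (T 1) v) = _
    rw [laurentHom_T, zpow_one]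
    exact φ.2 v
  · intro a u w
    change polar Q (laurentHom φ.1 a u) w = polar Q u (laurentHom φ.1 (invert a) w)
    induction a using LaurentPolynomial.induction_on' with
    | add p q hp hq =>
      rw [map_add, map_add, map_add, LinearMap.add_apply, LinearMap.add_apply, polar_add_left,
        polar_add_right, hp, hq]
    | C_mul_T n c =>
      have h : ∀ v, Q ((φ.1 ^ n) v) = Q v := fun v => (φ ^ n).2 v
      have hinv : ∀ v, (φ.1 ^ n) ((φ.1 ^ (-n)) v) = v := fun v => by
        rw [← LinearEquiv.mul_apply, ← zpow_add, add_neg_cancel, zpow_zero]; rfl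
      rw [map_mul invert, invert_C, invert_T, ← LaurentPolynomial.smul_eq_C_mul,
        ← LaurentPolynomial.smul_eq_C_mul, map_smul, map_smul,
        LinearMap.smul_apply, LinearMap.smul_apply, polar_smul_left, polar_smul_right,
        laurentHom_T, laurentHom_T]
      congr 1
      conv_lhs => rw [← hinv w]
      rw [polar, polar, ← map_add, h, h, h]
  · rw [hst]; simp
  · rw [hst]
    linear_combination (T 1 + T (-1) - 2 : K[T;T⁻¹]) * two - hTT
  · rw [hst]
    exact exists_eq_aeval_add_aeval_mul
  · intro v
    rw [T_one_sub_one_pow_smul, hm, LinearMap.zero_apply]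

end Laurent

end QuadSpace

/-! ### Bicyclic modules, semisimplicity, and the consequences of indecomposability. -/

namespace QuadSpace

open QuadraticMap

variable {K V : Type*} [Field K] [AddCommGroup V] [Module K V]

section Bicyclic

variable {f : Module.End K V} {m : ℕ}

theorem smul_one_quotient (I : Ideal K[X]) (a : K[X]) :
    a • (1 : K[X] ⧸ I) = Ideal.Quotient.mk I a :=
  congrArg (Ideal.Quotient.mk I) (mul_one a)

theorem BicyclicWith.exists_generators {p : K[X]} (h : BicyclicWith f p) :
    ∃ e e' : V, ∀ v, ∃ a b : K[X], v = aeval f a e + aeval f b e' := by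
  obtain ⟨L⟩ := h
  refine ⟨(Module.AEval'.of f).symm (L.symm (1, 0)), (Module.AEval'.of f).symm (L.symm (0, 1)),
    fun v => ?_⟩
  obtain ⟨a, ha⟩ := Ideal.Quotient.mk_surjective (L (Module.AEval'.of f v)).1
  obtain ⟨b, hb⟩ := Ideal.Quotient.mk_surjective (L (Module.AEval'.of f v)).2
  refine ⟨a, b, (Module.AEval'.of f).injective (L.injective ?_)⟩
  rw [map_add, ← Module.End.smul_def, ← Module.End.smul_def, Module.AEval.of_aeval_smul,
    Module.AEval.of_aeval_smul, LinearEquiv.apply_symm_apply, LinearEquiv.apply_symm_apply,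
    map_add, map_smul, map_smul, L.apply_symm_apply, L.apply_symm_apply]
  refine Prod.ext ?_ ?_
  · rw [← ha]
    simp [smul_one_quotient]
  · rw [← hb]
    simp [smul_one_quotient]

theorem BicyclicWith.aeval_apply_eq_zero {p q : K[X]} (h : BicyclicWith f p) (hpq : p ∣ q) (v : V) :
    aeval f q v = 0 := by
  obtain ⟨L⟩ := h
  refine (Module.AEval'.of f).injective (L.injective ?_)
  rw [← Module.End.smul_def, Module.AEval.of_aeval_smul, map_smul, map_zero, map_zero]
  have hq : ∀ x : K[X] ⧸ Ideal.span {p}, q • x = 0 := fun x => by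
    obtain ⟨y, rfl⟩ := Ideal.Quotient.mk_surjective x
    change Ideal.Quotient.mk _ (q * y) = 0
    exact Ideal.Quotient.eq_zero_iff_mem.mpr (Ideal.mem_span_singleton.mpr (hpq.mul_right y))
  exact Prod.ext (hq _) (hq _)

theorem BicyclicWith.dvd_of_aeval_eq_zero {p q : K[X]} (h : BicyclicWith f p)
    (hq : aeval f q = 0) : p ∣ q := by
  obtain ⟨L⟩ := h
  have h0 : q • L.symm (1, 0) = 0 := by
    rw [← (Module.AEval'.of f).apply_symm_apply (L.symm (1, 0)), ← Module.AEval.of_aeval_smul, hq,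
      zero_smul, map_zero]
  rw [← map_smul, LinearEquiv.map_eq_zero_iff] at h0
  have := congrArg Prod.fst h0
  rw [← Ideal.mem_span_singleton, ← Ideal.Quotient.eq_zero_iff_mem]
  simpa [smul_one_quotient] using this

theorem BicyclicWith.finrank_eq {p : K[X]} (hp : p ≠ 0) (h : BicyclicWith f p) :
    Module.finrank K V = 2 * p.natDegree := by
  obtain ⟨L⟩ := h
  rw [LinearEquiv.finrank_eq ((Module.AEval'.of f).trans (L.restrictScalars K))]
  have : Module.Finite K (K[X] ⧸ Ideal.span {p}) := by
    have := (AdjoinRoot.powerBasis hp).finite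
    exact this
  rw [Module.finrank_prod, finrank_quotient_span_eq_natDegree, two_mul]

theorem BicyclicWith.natDegree_minpoly {p : K[X]} (hp : p.Monic) (h : BicyclicWith f p) :
    (minpoly K f).natDegree = p.natDegree := by
  have hf : aeval f p = 0 := LinearMap.ext (h.aeval_apply_eq_zero dvd_rfl)
  have : p = minpoly K f := minpoly.unique _ _ hp hf fun q hq hq0 =>
    degree_le_of_dvd (h.dvd_of_aeval_eq_zero hq0) hq.ne_zero
  rw [← this]

end Bicyclic

section Semisimple

variable [CharP K 2]

theorem one_add_pow_two_pow {A : Type*} [CommRing A] (h : (2 : A) = 0) (t : A) (n : ℕ) :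
    (1 + t) ^ 2 ^ n = 1 + t ^ 2 ^ n := by
  induction n with
  | zero => simp
  | succ n ih =>
    rw [pow_succ, pow_mul, ih, pow_mul]
    linear_combination t ^ 2 ^ n * h

theorem separable_minpoly_of_sq_add_self_add_one (g : Module.End K V)
    (h : ∀ v, g (g v) + g v + v = 0) : (minpoly K g).Separable := by
  have hsep : (X ^ 2 + X + 1 : K[X]).Separable := by
    rw [separable_def]
    have two : (2 : K[X]) = 0 := algebra_two_eq_zero K _
    have hd : derivative (X ^ 2 + X + 1 : K[X]) = 1 := by
      simp only [derivative_add, derivative_X_pow, derivative_X, derivative_one]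
      simp [CharTwo.two_eq_zero]
    rw [hd]
    exact isCoprime_one_right
  refine hsep.of_dvd (minpoly.dvd _ _ (LinearMap.ext fun v => ?_))
  simpa [pow_two] using h v

theorem pow_three_of_sq_add_self_add_one {g : V →ₗ[K] V} (h : ∀ v, g (g v) + g v + v = 0) (v : V) :
    g (g (g v)) = v := by
  have h1 := h v
  have h2 := h (g v)
  calc g (g (g v)) = (g (g (g v)) + g (g v) + g v) - (g (g v) + g v + v) + v := by abel
    _ = v := by rw [h1, h2, sub_zero, zero_add]

end Semisimple

section Main

variable [CharP K 2]

theorem Nondefective.eq_zero {Q : QuadraticForm K V} (hQ : Nondefective Q) {v : V}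
    (h : ∀ w, polar Q v w = 0) : v = 0 :=
  hQ.1 v h

/-- The residue form of an orthogonally indecomposable isometry is alternating if the space is not
cyclic. -/
theorem OrthogonallyIndecomposable.polar_pow_smul_self {A : Type*} [CommRing A] [Algebra K A]
    [Module A V] [IsScalarTower K A V] {Q : QuadraticForm K V} {st : A →ₐ[K] A} {t : A} {m n : ℕ}
    (H : UnipotentAction Q st t m) (h : n + 1 = m) {φ : O Q}
    (hφ : OrthogonallyIndecomposable φ) (hφt : ∀ v, φ.1 v = (1 + t) • v)
    (hdim : m < Module.finrank K V) (v : V) : polar Q (t ^ n • v) v = 0 := by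
  by_contra hv
  have hsep : ∀ x ∈ LinearMap.range (orbitMap (K := K) A v),
      (∀ y ∈ LinearMap.range (orbitMap (K := K) A v), polar Q y x = 0) → x = 0 := by
    rintro _ ⟨a, rfl⟩ ha
    exact H.smul_eq_zero_of_forall_polar h hv fun b => ha _ ⟨b, rfl⟩
  have hinv : Invariant (toEnd φ.1) (LinearMap.range (orbitMap (K := K) A v)) := by
    rintro _ ⟨a, rfl⟩
    exact ⟨(1 + t) * a, by
      simp only [orbitMap_apply, mul_smul]
      exact (hφt _).symm⟩
  have hnd : Nondefective (Q.comp (LinearMap.range (orbitMap (K := K) A v)).subtype) := by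
    constructor
    · intro x hx
      exact Subtype.ext (hsep x x.2 fun y hy => by
        rw [polar_comm]
        exact hx ⟨y, hy⟩)
    · intro x hx
      exact Subtype.ext (hsep x x.2 fun y hy => hx ⟨y, hy⟩)
  rcases hφ _ hinv hnd with h0 | h0
  · have hv0 : v ∈ LinearMap.range (orbitMap (K := K) A v) := ⟨1, by simp⟩
    rw [h0, Submodule.mem_bot] at hv0
    rw [hv0, polar_zero_right] at hv
    exact hv rfl
  · have := H.finrank_range_orbitMap_le v
    rw [h0, finrank_top] at this
    omega

/-- Take `η = s φ` with `s` of order three and `s e = e'`. As `4 ^ m` is a large power of 2 and is 1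
modulo 3, `η ^ (4 ^ m) = s`. Hence the span of the `η`-orbit of `e` is stable under `s` and `φ`, and
contains the orbits of `e` and `e'`. -/
theorem UnipotentAction.exists_cyclic {A : Type*} [CommRing A] [Algebra K A]
    [Module A V] [IsScalarTower K A V] {Q : QuadraticForm K V} {st : A →ₐ[K] A} {t : A} {m n : ℕ}
    (H : UnipotentAction Q st t m) (h : n + 1 = m) {φ : O Q} (hφt : ∀ v, φ.1 v = (1 + t) • v)
    (halt : ∀ v, polar Q (t ^ n • v) v = 0) {e e' : V} (hne : polar Q (t ^ n • e) e' ≠ 0)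
    (hgen : ∀ v : V, ∃ a b : A, v = a • e + b • e')
    (he : ∀ a : A, Q (a • e) = 0) (he' : ∀ a : A, Q (a • e') = 0)
    (hee' : ∀ a : A, polar Q (a • e) (a • e') = 0) :
    ∃ η : O Q, IsCyclicEnd (toEnd η.1) ∧ ∃ s : V ≃ₗ[K] V, η.1 = s * φ.1 ∧ Commute s φ.1 ∧
      (minpoly K (toEnd s)).Separable := by
  obtain ⟨g, hge, hg, hgQ, hgA⟩ := H.exists_isometry_order_three h halt hne hgen he he' hee'
  have hg3 := pow_three_of_sq_add_self_add_one hg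
  let s : V ≃ₗ[K] V := LinearEquiv.ofLinearMap g (g ∘ₗ g) (LinearMap.ext hg3) (LinearMap.ext hg3)
  have hs : ∀ v, s v = g v := fun v => rfl
  have hsO : s ∈ O Q := hgQ
  have hcomm : Commute s φ.1 := LinearEquiv.ext fun v => by
    rw [LinearEquiv.mul_apply, LinearEquiv.mul_apply, hs, hs, hφt, hφt, hgA]
  have hs3 : s ^ 3 = 1 := LinearEquiv.ext fun v => hg3 v
  have hs4 : ∀ j : ℕ, s ^ 4 ^ j = s := by
    intro j
    induction j with
    | zero => simp
    | succ j ih => rw [pow_succ, pow_mul, ih, pow_succ, hs3, one_mul]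
  have hφpow : ∀ (j : ℕ) v, (φ.1 ^ j) v = (1 + t) ^ j • v := by
    intro j
    induction j with
    | zero => exact fun v => by simp
    | succ j ih =>
      intro v
      rw [pow_succ', LinearEquiv.mul_apply, hφt, ih, smul_smul, ← pow_succ']
  have hφm : φ.1 ^ 4 ^ m = 1 := LinearEquiv.ext fun v => by
    rw [hφpow, show (4 : ℕ) ^ m = 2 ^ (2 * m) by rw [pow_mul]; norm_num,
      one_add_pow_two_pow (algebra_two_eq_zero K A), add_smul, one_smul,
      H.pow_smul_of_le (Nat.lt_two_pow_self.le.trans (Nat.pow_le_pow_right (by norm_num)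
        (by omega))), add_zero]
    rfl
  refine ⟨⟨s, hsO⟩ * φ, ⟨e, ?_⟩, s, rfl, hcomm, separable_minpoly_of_sq_add_self_add_one _ hg⟩
  set η : V ≃ₗ[K] V := s * φ.1 with hη
  change Submodule.span K (Set.range fun k : ℕ => (toEnd η ^ k) e) = ⊤
  obtain ⟨M, hM⟩ : ∃ M, M = Submodule.span K (Set.range fun k : ℕ => (toEnd η ^ k) e) := ⟨_, rfl⟩
  rw [← hM]
  have hηM : ∀ v ∈ M, η v ∈ M := by
    have : M ≤ M.comap (toEnd η) := by
      conv_lhs => rw [hM]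
      rw [Submodule.span_le]
      rintro _ ⟨j, rfl⟩
      rw [hM]
      exact Submodule.subset_span ⟨j + 1, by simp only [pow_succ']; rfl⟩
    exact fun v hv => this hv
  have hηpow : ∀ (j : ℕ), ∀ v ∈ M, (η ^ j) v ∈ M := by
    intro j
    induction j with
    | zero => exact fun v hv => hv
    | succ j ih =>
      intro v hv
      rw [pow_succ']
      exact hηM _ (ih v hv)
  have hsM : ∀ v ∈ M, g v ∈ M := by
    intro v hv
    have := hηpow (4 ^ m) v hv
    rwa [hη, hcomm.mul_pow, hs4, hφm, mul_one] at this
  have htM : ∀ v ∈ M, t • v ∈ M := by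
    intro v hv
    have h1 : φ.1 v ∈ M := by
      have := hsM _ (hsM _ (hηM v hv))
      rwa [hη, LinearEquiv.mul_apply, hs, hg3] at this
    rw [hφt, add_smul, one_smul] at h1
    simpa using sub_mem h1 hv
  have heM : e ∈ M := by
    rw [hM]
    exact Submodule.subset_span ⟨0, by simp⟩
  have hAM : ∀ a : A, a • e ∈ M := by
    have hpow : ∀ j : ℕ, t ^ j • e ∈ M := by
      intro j
      induction j with
      | zero => simpa using heM
      | succ j ih => rw [pow_succ', mul_smul]; exact htM _ ih
    intro a
    obtain ⟨p, hp⟩ := H.exists_smul_eq_aeval a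
    rw [hp]
    clear hp
    induction p using Polynomial.induction_on' with
    | add p q hp hq => rw [map_add, add_smul]; exact add_mem hp hq
    | monomial i c =>
      rw [aeval_monomial, ← Algebra.smul_def, smul_assoc]
      exact Submodule.smul_mem _ _ (hpow i)
  rw [eq_top_iff]
  intro v _
  obtain ⟨a, b, rfl⟩ := hgen v
  refine add_mem (hAM a) ?_
  rw [← hge]
  exact hsM _ (hAM b)

/-- Stated without scalars: the module structure from `ψ` stays local, as the main proof lets the
same algebra act through `φ`. -/
theorem map_sub_one_pow_apply {Q : QuadraticForm K V} (ψ : O Q) {j : ℕ} (hj : 1 ≤ j)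
    (h : (toEnd ψ.1 - 1) ^ (2 * j) = 0) (v : V) :
    Q (((toEnd ψ.1 - 1) ^ j) v) = polar Q (((toEnd ψ.1 - 1) ^ (2 * j - 1)) v) v := by
  let _ := laurentModule ψ.1
  have := isScalarTower_laurentModule ψ.1
  have H := unipotentAction_laurent ψ h
  have := H.map_pow_smul_eq hj rfl v
  rwa [T_one_sub_one_pow_smul, T_one_sub_one_pow_smul] at this

end Main

end QuadSpace

theorem proposition1p4 {K V : Type*} [Field K] [CharP K 2] [AddCommGroup V] [Module K V]
    [FiniteDimensional K V] (Q : QuadraticForm K V) (hQ : QuadSpace.Nondefective Q)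
    (φ : QuadSpace.O Q) (hφ : QuadSpace.IsType1 φ) :
    (QuadSpace.IsType1e φ →
      QuadSpace.IsHyperbolic φ ∧
      ∃ η : QuadSpace.O Q, QuadSpace.IsCyclicEnd (QuadSpace.toEnd η.1) ∧
        ∃ s : V ≃ₗ[K] V, QuadSpace.IsJordanChevalley η.1 s φ.1) ∧
    ((∃ ψ : QuadSpace.O Q, ψ ^ 2 = φ) ↔ QuadSpace.IsType1o φ) := by
  open QuadSpace QuadraticMap LaurentPolynomial in
  have htype := hφ
  obtain ⟨hind, m, hm, hbi⟩ := hφ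
  have hbi : BicyclicWith (toEnd φ.1) ((X - 1) ^ m) := by
    rcases hbi with h | h
    · exact h
    · rwa [show (X - 1 : K[X]) = X + 1 by linear_combination -algebra_two_eq_zero K K[X]]
  have hmonic : ((X - 1) ^ m : K[X]).Monic := by
    simpa using (monic_X_sub_C (1 : K)).pow m
  have hdeg : ((X - 1) ^ m : K[X]).natDegree = m := by
    have := natDegree_X_sub_C (1 : K)
    rw [map_one] at this
    rw [natDegree_pow, this, mul_one]
  have hminpoly := hbi.natDegree_minpoly hmonic
  have hdim := hbi.finrank_eq hmonic.ne_zero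
  rw [hdeg] at hminpoly hdim
  have haeval : ∀ j : ℕ, aeval (toEnd φ.1) ((X - 1) ^ j : K[X]) = (toEnd φ.1 - 1) ^ j := by simp
  have hnil : (toEnd φ.1 - 1) ^ m = 0 := by
    rw [← haeval]
    exact LinearMap.ext (hbi.aeval_apply_eq_zero dvd_rfl)
  let _ := laurentModule φ.1
  have := isScalarTower_laurentModule φ.1
  have H := unipotentAction_laurent φ hnil
  have hnd : ∀ v, (∀ w, polar Q v w = 0) → v = 0 := fun v => hQ.eq_zero
  obtain ⟨n, rfl⟩ := Nat.exists_eq_add_of_le' hm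
  have hφt : ∀ v, φ.1 v = (1 + (T 1 - 1 : K[T;T⁻¹])) • v := fun v => by
    rw [add_sub_cancel]
    exact (laurentHom_T φ.1 1 v).symm
  have ht : ∀ v, (T 1 - 1 : K[T;T⁻¹]) • v = (toEnd φ.1 - 1) v := fun v => by
    have := T_one_sub_one_pow_smul φ.1 1 v
    rwa [pow_one, pow_one] at this
  have halt := hind.polar_pow_smul_self H rfl hφt (by omega)
  have hn : ∃ v : V, (T 1 - 1 : K[T;T⁻¹]) ^ n • v ≠ 0 := by
    by_contra! hcon
    have h0 : (toEnd φ.1 - 1) ^ n = 0 := LinearMap.ext fun v => by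
      rw [← T_one_sub_one_pow_smul, hcon]; rfl
    have := natDegree_le_of_dvd (hbi.dvd_of_aeval_eq_zero ((haeval n).trans h0))
      ((by simpa using (monic_X_sub_C (1 : K)).pow n : ((X - 1) ^ n : K[X]).Monic).ne_zero)
    have hX := natDegree_X_sub_C (1 : K)
    rw [map_one] at hX
    rw [natDegree_pow, natDegree_pow, hX] at this
    omega
  obtain ⟨e, e', hgen⟩ := hbi.exists_generators
  have hpoly : ∀ (p : K[X]) (v : V), aeval (toEnd φ.1) p v = (toLaurentAlg p : K[T;T⁻¹]) • v := by
    intro p v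
    change _ = laurentHom φ.1 (toLaurentAlg p) v
    have : aeval (toEnd φ.1) = (laurentHom φ.1).comp (toLaurentAlg (R := K)) := by
      ext w
      simp [laurentHom_T]
    rw [this]
    rfl
  have hgen : ∀ v : V, ∃ a b : K[T;T⁻¹], v = a • e + b • e' := fun v => by
    obtain ⟨p, q, hpq⟩ := hgen v
    exact ⟨toLaurentAlg p, toLaurentAlg q, by rw [← hpoly, ← hpoly, ← hpq]⟩
  have hne := H.polar_pow_smul_ne_zero rfl hnd halt hgen hn
  refine ⟨fun he => ?_, fun ⟨ψ, hψ⟩ => ⟨htype, ?_⟩, fun ho => ?_⟩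
  · obtain ⟨k, hk⟩ := even_iff_two_dvd.mp (hminpoly ▸ he.2)
    obtain rfl : n = 2 * k - 1 := by omega
    rw [hk] at H
    have hQk : ∀ v : V, Q ((T 1 - 1 : K[T;T⁻¹]) ^ k • v) = 0 := fun v => by
      rw [H.map_pow_smul_eq (by omega) rfl, halt]
    obtain ⟨u, w, huw, hgen', hu, hw, hd⟩ :=
      H.exists_hyperbolic_generators (by omega) hQk hne hgen
    have hinv : ∀ x, Invariant (toEnd φ.1) (LinearMap.range (orbitMap (K := K) K[T;T⁻¹] x)) := by
      rintro x _ ⟨a, rfl⟩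
      exact ⟨(1 + (T 1 - 1)) * a, by rw [orbitMap_apply, orbitMap_apply, mul_smul, ← hφt]; rfl⟩
    refine ⟨⟨_, _, H.isCompl_range_orbitMap (by omega) halt huw hgen', ?_, ?_, hinv u, hinv w⟩, ?_⟩
    · rintro _ ⟨a, rfl⟩
      exact hu a
    · rintro _ ⟨a, rfl⟩
      exact hw a
    · obtain ⟨η, hη, s, h1, h2, h3⟩ :=
        H.exists_cyclic (by omega) hφt halt huw hgen' hu hw hd
      exact ⟨η, hη, s, h1, h2, h3, _, hnil⟩
  · rw [hminpoly]
    by_contra hodd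
    obtain ⟨k, hk⟩ := even_iff_two_dvd.mp (Nat.not_odd_iff_even.mp hodd)
    have hψ2 : ∀ v, ψ.1 (ψ.1 v) = φ.1 v := fun v => by
      rw [← hψ, pow_two]; rfl
    have hsq : (toEnd ψ.1 - 1) ^ 2 = toEnd φ.1 - 1 := by
      ext v
      have two : (2 : K) = 0 := algebra_two_eq_zero K K
      have := hψ2 v
      rw [pow_two]
      simp only [Module.End.mul_apply, LinearMap.sub_apply, map_sub, Module.End.one_apply]
      change ψ.1 (ψ.1 v) - ψ.1 v - (ψ.1 v - v) = φ.1 v - v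
      rw [this, ← sub_eq_zero, show φ.1 v - ψ.1 v - (ψ.1 v - v) - (φ.1 v - v) =
        (2 : K) • (v - ψ.1 v) by rw [two_smul]; abel, two, zero_smul]
    have hψt : ∀ v, (toEnd ψ.1 - 1) ((toEnd ψ.1 - 1) v) = (T 1 - 1 : K[T;T⁻¹]) • v := fun v => by
      rw [ht, ← hsq, pow_two]; rfl
    refine hn.elim fun v hv => hv ?_
    have ht0 := H.eq_zero_of_sq_eq rfl halt hne hgen hψt
      (fun v => by rw [← hψt, ← hψt]) (fun v => ?_)
    -- Here `n ≥ 1` because `n + 1` is even.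
    · obtain ⟨j, rfl⟩ : ∃ j, n = j + 1 := ⟨n - 1, by omega⟩
      rw [pow_succ, mul_smul, ht0, smul_zero]
    -- With `s = ψ - 1` and `n + 1 = 2k`, one has `s ^ (n + 1) = t ^ k`, on which `Q` vanishes; the
    -- right side is `f(t ^ n s v, v)`.
    · have h0 := map_sub_one_pow_apply ψ (j := n + 1) (by omega)
        (by rw [pow_mul, hsq, hnil]) v
      rw [hk, pow_mul, hsq, ← T_one_sub_one_pow_smul, ← hk] at h0
      rw [hk] at H
      rw [H.map_pow_smul_eq (by omega) rfl, ← hk, Nat.add_sub_cancel, halt] at h0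
      rw [H.polar_pow_smul_left (by omega), T_one_sub_one_pow_smul, ← hsq, ← pow_mul,
        ← Module.End.mul_apply, ← pow_succ, polar_comm, show 2 * n + 1 = 2 * (n + 1) - 1 by omega,
        ← h0]
  · obtain ⟨k, hk⟩ := hminpoly ▸ ho.2
    obtain rfl : n = 2 * k := by omega
    -- The form `v ↦ Q(t ^ k v)` polarizes to the residue form, nonzero at `(e, e')`, so it is
    -- nonzero at one of `e'`, `e`, `e + e'`.
    have hQk : ∃ u u' : V, polar Q ((T 1 - 1 : K[T;T⁻¹]) ^ (2 * k) • u) u' ≠ 0 ∧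
        (∀ v : V, ∃ a b : K[T;T⁻¹], v = a • u + b • u') ∧
        Q ((T 1 - 1 : K[T;T⁻¹]) ^ k • u') ≠ 0 := by
      by_cases h1 : Q ((T 1 - 1 : K[T;T⁻¹]) ^ k • e') = 0
      · by_cases h2 : Q ((T 1 - 1 : K[T;T⁻¹]) ^ k • e) = 0
        · refine ⟨e, e + e', ?_, fun v => ?_, ?_⟩
          · rwa [polar_add_right, halt, zero_add]
          · obtain ⟨a, b, rfl⟩ := hgen v
            exact ⟨a - b, b, by module⟩
          · rwa [smul_add, map_add_eq, h1, h2, zero_add, zero_add,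
              H.polar_pow_smul_eq rfl (by omega)]
        · refine ⟨e', e, ?_, fun v => ?_, h2⟩
          · rwa [polar_comm, ← H.polar_pow_smul_left rfl]
          · obtain ⟨a, b, rfl⟩ := hgen v
            exact ⟨b, a, add_comm _ _⟩
      · exact ⟨e, e', hne, hgen, h1⟩
    obtain ⟨u, u', huu', hgenu, hQu⟩ := hQk
    obtain ⟨w, huw, hgenw, hw1, hw2, hw3⟩ := H.exists_sqrt_generators huu' hgenu hQu
    obtain ⟨g, hg, hgQ⟩ := H.exists_isometry_sq rfl halt huw hgenw hw1 hw2 hw3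
    have hinj : Function.Injective g := fun x y hxy => φ.1.injective (by
      rw [hφt, hφt, ← hg, ← hg, hxy])
    refine ⟨⟨LinearEquiv.ofInjectiveEndo g hinj, hgQ⟩, Subtype.ext (LinearEquiv.ext fun v => ?_)⟩
    rw [pow_two, hφt, ← hg]
    rfl
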